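/- **Theorem 3.1 (Validity of the multiplier bootstrap for high-dimensional means).** Let $p\ge 3$ and let $x_1,\dots,x_n$ be independent centered random vectors in $\mathbb{R}^p$ with finite second moments, $x_i=(x_{i1},\dots,x_{ip})'$. Let $y_1,\dots,y_n$ be independent with $y_i\sim N(0,\mathrm{E}[x_ix_i'])$, and let $e_1,\dots,e_n$ be i.i.d. $N(0,1)$ variables independent of $(x_i)_{i=1}^n$. Put $$T_0=\max_{1\le j\le p}\frac1{\sqrt n}\sum_{i=1}^n x_{ij},\qquad Z_0=\max_{1\le j\le p}\frac1{\sqrt n}\sum_{i=1}^n y_{ij},\qquad W_0=\max_{1\le j\le p}\frac1{\sqrt n}\sum_{i=1}^n x_{ij}e_i .$$ Let $\Pr_e$ denote probability with respect to $(e_i)_{i=1}^n$ with $(x_i)_{i=1}^n$ held fixed, and for $\alpha\in(0,1)$ let $$c_{W_0}(\alpha)=\inf\{t\in\mathbb{R}:\Pr\nolimits_e(W_0\le t)\ge\alpha\},\qquad c_{Z_0}(\alpha)=\inf\{t\in\mathbb{R}:\Pr(Z_0\le t)\ge\alpha\}.$$ Further let $$\Delta=\max_{1\le j,k\le p}\Big|\frac1n\sum_{i=1}^n\big(x_{ij}x_{ik}-\mathrm{E}[x_{ij}x_{ik}]\big)\Big|,\qquad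 \rho=\sup_{t\in\mathbb{R}}|\Pr(T_0\le t)-\Pr(Z_0\le t)|,$$ $$\rho_\ominus=\sup_{\alpha\in(0,1)}\Pr\big(\{T_0\le c_{W_0}(\alpha)\}\,\triangle\,\{T_0\le c_{Z_0}(\alpha)\}\big).$$ Suppose that $c_1\le \frac1n\sum_{i=1}^n\mathrm{E}[x_{ij}^2]\le C_1$ for all $1\le j\le p$, where $0<c_1<C_1$ are constants. Then there is a constant $C>0$ depending only on $c_1$ and $C_1$ such that for every $\vartheta>0$, $$\rho_\ominus\le 2\big(\rho+\pi(\vartheta)+\Pr(\Delta>\vartheta)\big),\qquad \pi(\vartheta)=C\,\vartheta^{1/3}\big(1\vee\log(p/\vartheta)\big)^{2/3}.$$ In addition, $$\sup_{\alpha\in(0,1)}\big|\Pr(T_0\le c_{W_0}(\alpha))-\alpha\big|\le\rho_\ominus+\rho .$$ -/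

import Mathlib

open MeasureTheory ProbabilityTheory

namespace MultiplierBootstrap

noncomputable section

/-- The largest coordinate `max_{1 ≤ j ≤ p} v_j` of a finite family of real numbers (used for `p ≥ 1`). -/
def maxCoord {p : ℕ} (v : Fin p → ℝ) : ℝ := ⨆ j, v j

/-- The maximum coordinate of the normalized sum,
`max_{1 ≤ j ≤ p} n^{-1/2} ∑_{i=1}^n v_{ij}`. -/
def maxSum {n p : ℕ} (v : Fin n → EuclideanSpace ℝ (Fin p)) : ℝ :=
  maxCoord fun j => (√(n : ℝ))⁻¹ * ∑ i, v i j

/-- The multiplier statistic for data `v` and multipliers `a`,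
`max_{1 ≤ j ≤ p} n^{-1/2} ∑_{i=1}^n v_{ij} a_i`. -/
def maxMultSum {n p : ℕ} (v : Fin n → EuclideanSpace ℝ (Fin p)) (a : Fin n → ℝ) : ℝ :=
  maxCoord fun j => (√(n : ℝ))⁻¹ * ∑ i, v i j * a i

/-- The `α`-quantile `inf {t : F(t) ≥ α}` of a distribution function `F`. -/
def quantile (F : ℝ → ℝ) (α : ℝ) : ℝ := sInf {t : ℝ | α ≤ F t}

variable {Ω : Type*} [MeasurableSpace Ω]

/-- The second moment matrix `E[ξ ξ']` of a random vector; for a centered `ξ` this is its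
covariance matrix. -/
def secondMoment (P : Measure Ω) {p : ℕ} (ξ : Ω → EuclideanSpace ℝ (Fin p)) :
    Matrix (Fin p) (Fin p) ℝ :=
  Matrix.of fun j k => ∫ ω, ξ ω j * ξ ω k ∂P

/-- `T₀` (and also `Z₀`, for the Gaussian vectors): the statistic `maxSum` of the random vectors
`x 1, …, x n`. -/
def statT {n p : ℕ} (x : Fin n → Ω → EuclideanSpace ℝ (Fin p)) (ω : Ω) : ℝ :=
  maxSum fun i => x i ω

/-- The probability `P_e(W₀ ≤ t)` at the data realized at `ω`: the probability with respect to the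
multipliers `e` alone, the data `x 1 ω, …, x n ω` being held fixed. -/
def condCDF_W {n p : ℕ} (P : Measure Ω) (x : Fin n → Ω → EuclideanSpace ℝ (Fin p))
    (e : Fin n → Ω → ℝ) (ω : Ω) (t : ℝ) : ℝ :=
  P.real {ω' | maxMultSum (fun i => x i ω) (fun i => e i ω') ≤ t}

/-- The conditional quantile `c_{W₀}(α)`, a function of the data. -/
def quantileW {n p : ℕ} (P : Measure Ω) (x : Fin n → Ω → EuclideanSpace ℝ (Fin p))
    (e : Fin n → Ω → ℝ) (α : ℝ) (ω : Ω) : ℝ :=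
  quantile (condCDF_W P x e ω) α

/-- The quantile `c_{Z₀}(α)` of `Z₀ = max_j n^{-1/2} ∑_i y_{ij}`. -/
def quantileZ {n p : ℕ} (P : Measure Ω) (y : Fin n → Ω → EuclideanSpace ℝ (Fin p)) (α : ℝ) : ℝ :=
  quantile (fun t => P.real {ω | statT y ω ≤ t}) α

/-- `Δ = max_{j,k} |n^{-1} ∑_i (x_{ij} x_{ik} - E[x_{ij} x_{ik}])|`. -/
def covDeviation {n p : ℕ} (P : Measure Ω) (x : Fin n → Ω → EuclideanSpace ℝ (Fin p))
    (ω : Ω) : ℝ :=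
  maxCoord fun j => maxCoord fun k =>
    |(n : ℝ)⁻¹ * ∑ i, (x i ω j * x i ω k - secondMoment P (x i) j k)|

/-- `ρ = sup_t |P(T₀ ≤ t) - P(Z₀ ≤ t)|`. -/
def rho {n p : ℕ} (P : Measure Ω) (x y : Fin n → Ω → EuclideanSpace ℝ (Fin p)) : ℝ :=
  ⨆ t : ℝ, |P.real {ω | statT x ω ≤ t} - P.real {ω | statT y ω ≤ t}|

/-- The supremum over `α ∈ (0,1)` of the probability of the symmetric difference of
`{T₀ ≤ c_{W₀}(α)}` and `{T₀ ≤ c_{Z₀}(α)}`. -/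
def rhoSymm {n p : ℕ} (P : Measure Ω) (x y : Fin n → Ω → EuclideanSpace ℝ (Fin p))
    (e : Fin n → Ω → ℝ) : ℝ :=
  ⨆ α : Set.Ioo (0 : ℝ) 1,
    P.real (symmDiff {ω | statT x ω ≤ quantileW P x e α ω} {ω | statT x ω ≤ quantileZ P y α})

/-- `π(ϑ) = C ϑ^{1/3} (1 ∨ log(p/ϑ))^{2/3}`. -/
def piBound (C : ℝ) (p : ℕ) (ϑ : ℝ) : ℝ :=
  C * ϑ ^ (1 / 3 : ℝ) * (max 1 (Real.log (p / ϑ))) ^ (2 / 3 : ℝ)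

end

end MultiplierBootstrap

/-!
# Validity of the multiplier bootstrap for high-dimensional means

Given the data, the multiplier statistic `W₀` is the maximum of a centered Gaussian vector whose
covariance matrix is the empirical second moment matrix, while `Z₀` is the maximum of one whose
covariance matrix is its expectation. So the bootstrap works as soon as the law of a Gaussian
maximum depends continuously, in Kolmogorov distance, on the covariance matrix in the entrywise
sup norm; `Δ` is the distance between the two matrices.

This continuity is `exists_abs_measureReal_maxCoord_sub_le`, with modulus `ϑ^{1/3} (log p)^{2/3}`.
It balances two estimates.

* Smooth functions of the maximum. The indicator of `max ≤ t` is replaced by a smooth step of width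
  `δ` applied to the log-sum-exp function `smoothMax β` with `β = log p / δ`. Its Hessian has
  entrywise `ℓ¹` norm of order `log p / δ²` (`sum_sum_abs_stepHess_le`), so its Gaussian means change
  by at most the order of `ϑ log p / δ²` (`abs_integral_gaussian_sub_le`). The latter is shown by
  cutting both Gaussian measures into many independent pieces, exchanging these one by one, and
  expanding to second order; the third-order errors vanish as the pieces get smaller.
* Anti-concentration, `exists_measureReal_maxCoord_mem_Ioc_le`: the maximum falls into an interval of
  length `ε` with probability at most of order `ε √(log p)`. The interval `(t, t + ε]` is split
  according to the index `j` at which `(y j - t) / σ j` is largest. Given the residuals of the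
  regression of the other coordinates on the `j`-th one, this event is monotone in the `j`-th
  coordinate, because correlations are at most `1`; hence the hazard rate of the maximum is bounded
  by that of a standard Gaussian variable, which is of order `1 + t / σ`. For `t` beyond the order
  of `√(log p)` the union bound absorbs this factor.

To pass to quantiles, let `F` be the distribution function of `Z₀`, which is continuous by
anti-concentration. When `Δ ≤ ϑ`, the conditional distribution function of `W₀` is within `π(ϑ)` of
`F`, so `T₀` can lie between the two `α`-quantiles only if `F(T₀)` is within `π(ϑ)` of `α`
(`cdf_mem_of_quantile_separates`). If `T₀` had the law of `Z₀`, this would have probability at most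
`2 π(ϑ)`; replacing one law by the other costs `2 ρ` (`measureReal_cdf_mem_Icc_le`).
For `ϑ ≥ 1` the bound is trivial, and for `ϑ < 1` the modulus is at most `π(ϑ)`.
-/

namespace MultiplierBootstrap

/-! ### Algebra of centered Gaussian measures -/

section GaussianAlgebra

open Matrix Complex

variable {p : ℕ}

lemma charFun_centeredGaussian {S : Matrix (Fin p) (Fin p) ℝ} (hS : S.PosSemidef)
    (t : EuclideanSpace ℝ (Fin p)) :
    charFun (multivariateGaussian 0 S) t =
      exp (-((((t : Fin p → ℝ) ⬝ᵥ S *ᵥ (t : Fin p → ℝ) : ℝ) : ℂ) / 2)) := by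
  rw [charFun_multivariateGaussian hS]
  simp

lemma conv_centeredGaussian {S S' : Matrix (Fin p) (Fin p) ℝ} (hS : S.PosSemidef)
    (hS' : S'.PosSemidef) :
    (multivariateGaussian 0 S) ∗ (multivariateGaussian 0 S') =
      multivariateGaussian 0 (S + S') := by
  apply Measure.ext_of_charFun
  ext t
  rw [charFun_conv, charFun_centeredGaussian hS, charFun_centeredGaussian hS',
    charFun_centeredGaussian (hS.add hS'), ← Complex.exp_add, add_mulVec, dotProduct_add]
  congr 1
  push_cast
  ring

lemma map_smul_centeredGaussian {S : Matrix (Fin p) (Fin p) ℝ} (hS : S.PosSemidef) (c : ℝ) :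
    (multivariateGaussian 0 S).map (fun x => c • x) = multivariateGaussian 0 (c ^ 2 • S) := by
  apply Measure.ext_of_charFun
  ext t
  rw [charFun_map_smul, charFun_centeredGaussian hS,
    charFun_centeredGaussian (hS.smul (sq_nonneg c))]
  congr 1
  simp only [WithLp.ofLp_smul, smul_mulVec, mulVec_smul, smul_dotProduct, dotProduct_smul,
    smul_eq_mul]
  push_cast
  ring

lemma hasLaw_smul_sum_centeredGaussian {Ω : Type*} [MeasurableSpace Ω] {P : Measure Ω}
    [IsProbabilityMeasure P] {n : ℕ} {y : Fin n → Ω → EuclideanSpace ℝ (Fin p)}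
    {S : Fin n → Matrix (Fin p) (Fin p) ℝ} (hS : ∀ i, (S i).PosSemidef)
    (hy : ∀ i, HasLaw (y i) (multivariateGaussian 0 (S i)) P) (hind : iIndepFun y P) (c : ℝ) :
    HasLaw (fun ω => c • ∑ i, y i ω) (multivariateGaussian 0 (c ^ 2 • ∑ i, S i)) P := by
  have hm : ∀ i, AEMeasurable (y i) P := fun i => (hy i).aemeasurable
  have hSS : (∑ i, S i).PosSemidef := Matrix.posSemidef_sum _ fun i _ => hS i
  have h1 : HasLaw (fun ω => ∑ i, y i ω) (multivariateGaussian 0 (∑ i, S i)) P := by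
    refine ⟨by fun_prop, ?_⟩
    apply Measure.ext_of_charFun
    ext t
    rw [hind.charFun_map_fun_sum_eq_prod hm, charFun_centeredGaussian hSS, Finset.prod_apply]
    simp_rw [fun i => (hy i).map_eq, fun i => charFun_centeredGaussian (hS i)]
    rw [← Complex.exp_sum, sum_mulVec, dotProduct_sum]
    congr 1
    push_cast
    rw [Finset.sum_neg_distrib, Finset.sum_div]
  have h2 : HasLaw (fun x : EuclideanSpace ℝ (Fin p) => c • x)
      (multivariateGaussian 0 (c ^ 2 • ∑ i, S i)) (multivariateGaussian 0 (∑ i, S i)) :=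
    ⟨by fun_prop, map_smul_centeredGaussian hSS c⟩
  exact h2.fun_comp h1

lemma posSemidef_vecMulVec_self (v : Fin p → ℝ) : (vecMulVec v v).PosSemidef := by
  simpa using posSemidef_vecMulVec_self_star v

/-- A scalar standard Gaussian times a fixed vector `v` is Gaussian with the rank-one covariance
`v vᵀ`. -/
lemma hasLaw_smul_gaussianReal {Ω : Type*} [MeasurableSpace Ω] {P : Measure Ω}
    [IsProbabilityMeasure P] {e : Ω → ℝ} (he : HasLaw e (gaussianReal 0 1) P)
    (v : EuclideanSpace ℝ (Fin p)) :
    HasLaw (fun ω => e ω • v) (multivariateGaussian 0 (vecMulVec v v)) P := by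
  have h2 : HasLaw (fun r : ℝ => r • v) (multivariateGaussian 0 (vecMulVec v v))
      (gaussianReal 0 1) := by
    refine ⟨by fun_prop, ?_⟩
    apply Measure.ext_of_charFun
    ext t
    rw [charFun_centeredGaussian (posSemidef_vecMulVec_self _), charFun_apply,
      integral_map (by fun_prop) (Measurable.aestronglyMeasurable (by fun_prop))]
    have := charFun_gaussianReal (μ := 0) (v := 1) (inner ℝ v t)
    rw [charFun_apply_real] at this
    simp_rw [real_inner_smul_left]
    have h3 : (inner ℝ v t : ℝ) = (t : Fin p → ℝ) ⬝ᵥ (v : Fin p → ℝ) := by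
      simp [PiLp.inner_apply, dotProduct]
    have h4 : (t : Fin p → ℝ) ⬝ᵥ vecMulVec (v : Fin p → ℝ) v *ᵥ (t : Fin p → ℝ)
        = (inner ℝ v t : ℝ) ^ 2 := by
      rw [vecMulVec_mulVec, dotProduct_smul, h3, dotProduct_comm]
      simp [sq, dotProduct_comm]
    rw [h4]
    convert this using 2
    · ext r
      push_cast
      ring_nf
    · push_cast
      simp
  exact h2.fun_comp he

lemma integral_coord_centeredGaussian (S : Matrix (Fin p) (Fin p) ℝ) (j : Fin p) :
    ∫ v, v j ∂(multivariateGaussian 0 S) = 0 := by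
  have := (EuclideanSpace.proj (𝕜 := ℝ) j).integral_comp_comm
    (IsGaussian.integrable_id (μ := multivariateGaussian 0 S))
  simpa using this

lemma memLp_coord_centeredGaussian (S : Matrix (Fin p) (Fin p) ℝ) (j : Fin p) :
    MemLp (fun v : EuclideanSpace ℝ (Fin p) => v j) 2 (multivariateGaussian 0 S) :=
  IsGaussian.memLp_dual (multivariateGaussian 0 S) (EuclideanSpace.proj (𝕜 := ℝ) j) 2 (by simp)

lemma integral_coord_mul_coord_centeredGaussian {S : Matrix (Fin p) (Fin p) ℝ}
    (hS : S.PosSemidef) (j k : Fin p) :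
    ∫ v, v j * v k ∂(multivariateGaussian 0 S) = S j k := by
  rw [← covariance_eval_multivariateGaussian (μ := 0) hS j k,
    covariance_eq_sub (memLp_coord_centeredGaussian S j) (memLp_coord_centeredGaussian S k),
    integral_coord_centeredGaussian]
  simp

lemma integrable_norm_pow_three_centeredGaussian (S : Matrix (Fin p) (Fin p) ℝ) :
    Integrable (fun v : EuclideanSpace ℝ (Fin p) => ‖v‖ ^ 3) (multivariateGaussian 0 S) := by
  simpa using (IsGaussian.memLp_id (multivariateGaussian 0 S) 3 (by simp)).integrable_norm_pow
    (by simp)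

end GaussianAlgebra

/-! ### Quantiles of distribution functions -/

section Quantile

open Filter Topology Set

lemma monotone_measureReal_Iic (μ : Measure ℝ) [IsProbabilityMeasure μ] :
    Monotone fun t => μ.real (Iic t) :=
  fun _ _ h => measureReal_mono (Iic_subset_Iic.2 h)

/-- The quantile function is the left Galois adjoint of the distribution function. -/
lemma quantile_le_iff (μ : Measure ℝ) [IsProbabilityMeasure μ] {α : ℝ} (hα : α ∈ Ioo (0 : ℝ) 1)
    (t : ℝ) : quantile (fun t => μ.real (Iic t)) α ≤ t ↔ α ≤ μ.real (Iic t) := by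
  simp_rw [← cdf_eq_real μ]
  set A := {t : ℝ | α ≤ cdf μ t} with hA
  have hne : A.Nonempty := ((tendsto_cdf_atTop μ).eventually (eventually_ge_nhds hα.2)).exists
  have hbdd : BddBelow A := by
    obtain ⟨b, hb⟩ := ((tendsto_cdf_atBot μ).eventually (eventually_lt_nhds hα.1)).exists
    exact ⟨b, fun s hs => le_of_not_gt fun hsb =>
      absurd (hs.trans (monotone_cdf μ hsb.le)) (not_le.2 hb)⟩
  refine ⟨fun h => ?_, fun h => csInf_le hbdd h⟩
  refine le_trans ?_ (monotone_cdf μ h)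
  -- The infimum is attained because the distribution function is right continuous.
  have hr : Tendsto (cdf μ) (𝓝[>] sInf A) (𝓝 (cdf μ (sInf A))) :=
    ((cdf μ).right_continuous (sInf A)).tendsto.mono_left (nhdsWithin_mono _ Ioi_subset_Ici_self)
  refine ge_of_tendsto hr ?_
  filter_upwards [self_mem_nhdsWithin] with s hs
  obtain ⟨r, hr, hrs⟩ := exists_lt_of_csInf_lt hne hs
  exact le_trans hr (monotone_cdf μ hrs.le)

lemma measureReal_Iic_quantile (μ : Measure ℝ) [IsProbabilityMeasure μ]
    (hc : Continuous fun t => μ.real (Iic t)) {α : ℝ} (hα : α ∈ Ioo (0 : ℝ) 1) :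
    μ.real (Iic (quantile (fun t => μ.real (Iic t)) α)) = α := by
  set q := quantile (fun t => μ.real (Iic t)) α
  refine le_antisymm ?_ ((quantile_le_iff μ hα q).1 le_rfl)
  refine le_of_tendsto ((hc.tendsto q).mono_left (nhdsWithin_le_nhds (s := Iio q))) ?_
  filter_upwards [self_mem_nhdsWithin] with s hs
  by_contra! h
  exact absurd ((quantile_le_iff μ hα s).2 h.le) (not_le.2 hs)

/-- If the distribution functions of `μ` and `ν` are within `ρ` and that of `ν` is continuous,
the `μ`-probability that the distribution function of `ν` lies in `[l, u]` exceeds `u - l` by at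
most `2ρ`. -/
lemma measureReal_cdf_mem_Icc_le (μ ν : Measure ℝ) [IsProbabilityMeasure μ]
    [IsProbabilityMeasure ν] (hc : Continuous fun t => ν.real (Iic t)) {ρ : ℝ}
    (hρ : ∀ t, |μ.real (Iic t) - ν.real (Iic t)| ≤ ρ) {l u : ℝ} (hl : l < 1) (hu : 0 < u)
    (hlu : l ≤ u) :
    μ.real {s | l ≤ ν.real (Iic s) ∧ ν.real (Iic s) ≤ u} ≤ u - l + 2 * ρ := by
  have hρ0 : 0 ≤ ρ := (abs_nonneg _).trans (hρ 0)
  set F := fun t => ν.real (Iic t) with hF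
  have hFm : Measurable F := hc.measurable
  have hupper : μ.real {s | F s ≤ u} ≤ u + ρ := by
    refine le_of_forall_gt_imp_ge_of_dense fun w hw => ?_
    rcases le_or_gt 1 (w - ρ) with h1 | h1
    · linarith [measureReal_le_one (μ := μ) (s := {s | F s ≤ u})]
    have hmem : w - ρ ∈ Ioo (0 : ℝ) 1 := ⟨by linarith, h1⟩
    have h2 := measureReal_Iic_quantile ν hc hmem
    have h3 := (abs_le.1 (hρ (quantile F (w - ρ)))).2
    have h4 : μ.real {s | F s ≤ u} ≤ μ.real (Iic (quantile F (w - ρ))) := by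
      refine measureReal_mono fun s hs => ?_
      simp only [mem_ofPred_eq] at hs
      by_contra h
      have := (quantile_le_iff ν hmem s).1 (not_le.1 h).le
      change w - ρ ≤ F s at this
      linarith
    linarith
  have hlower : l - ρ ≤ μ.real {s | F s < l} := by
    refine le_of_forall_lt_imp_le_of_dense fun w hw => ?_
    rcases le_or_gt (w + ρ) 0 with h1 | h1
    · linarith [measureReal_nonneg (μ := μ) (s := {s | F s < l})]
    have hmem : w + ρ ∈ Ioo (0 : ℝ) 1 := ⟨h1, by linarith⟩
    have h2 := measureReal_Iic_quantile ν hc hmem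
    have h3 := (abs_le.1 (hρ (quantile F (w + ρ)))).1
    have h4 : μ.real (Iic (quantile F (w + ρ))) ≤ μ.real {s | F s < l} := by
      refine measureReal_mono fun s hs => ?_
      have := monotone_measureReal_Iic ν (mem_Iic.1 hs)
      simp only [mem_ofPred_eq]
      change F s ≤ ν.real (Iic _) at this
      linarith
    linarith
  have hmeas : MeasurableSet {s | F s < l} := measurableSet_lt hFm measurable_const
  have hdis : Disjoint {s | l ≤ F s ∧ F s ≤ u} {s | F s < l} :=
    disjoint_left.2 fun s hs hs' => not_lt.2 (show l ≤ F s from hs.1) hs'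
  have hadd := measureReal_union (μ := μ) hdis hmeas
  have hsub : μ.real ({s | l ≤ F s ∧ F s ≤ u} ∪ {s | F s < l}) ≤ μ.real {s | F s ≤ u} := by
    refine measureReal_mono fun s hs => ?_
    rcases hs with hs | hs
    · exact hs.2
    · exact (le_of_lt (show F s < l from hs)).trans hlu
  linarith

end Quantile

/-! ### Calculus of the smooth maximum -/

section SmoothMax

open Finset

variable {p : ℕ}

/-- The log-sum-exp smoothing `β⁻¹ log ∑ⱼ exp (β zⱼ)` of the maximum coordinate. -/
noncomputable def smoothMax (β : ℝ) (z : Fin p → ℝ) : ℝ :=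
  β⁻¹ * Real.log (∑ j, Real.exp (β * z j))

/-- The softmax weights, that is, the gradient of `smoothMax`. -/
noncomputable def softmaxWeight (β : ℝ) (z : Fin p → ℝ) (j : Fin p) : ℝ :=
  Real.exp (β * z j) / ∑ k, Real.exp (β * z k)

/-- The `k`-th moment of the numbers `v j` under the softmax weights. -/
noncomputable def softmaxMoment (β : ℝ) (v z : Fin p → ℝ) (k : ℕ) : ℝ :=
  ∑ j, v j ^ k * softmaxWeight β z j

lemma sum_exp_pos [NeZero p] (β : ℝ) (z : Fin p → ℝ) : 0 < ∑ j, Real.exp (β * z j) :=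
  sum_pos (fun _ _ => Real.exp_pos _) ⟨0, mem_univ _⟩

lemma softmaxWeight_nonneg (β : ℝ) (z : Fin p → ℝ) (j : Fin p) : 0 ≤ softmaxWeight β z j := by
  unfold softmaxWeight
  positivity

lemma sum_softmaxWeight [NeZero p] (β : ℝ) (z : Fin p → ℝ) : ∑ j, softmaxWeight β z j = 1 := by
  unfold softmaxWeight
  rw [← sum_div, div_self (sum_exp_pos β z).ne']

lemma abs_softmaxMoment_le [NeZero p] (β : ℝ) {v : Fin p → ℝ} {r : ℝ} (hv : ∀ j, |v j| ≤ r)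
    (z : Fin p → ℝ) (k : ℕ) : |softmaxMoment β v z k| ≤ r ^ k := by
  calc |softmaxMoment β v z k| ≤ ∑ j, |v j ^ k * softmaxWeight β z j| := abs_sum_le_sum_abs _ _
    _ ≤ ∑ j, r ^ k * softmaxWeight β z j := by
        refine sum_le_sum fun j _ => ?_
        rw [abs_mul, abs_pow, abs_of_nonneg (softmaxWeight_nonneg β z j)]
        exact mul_le_mul_of_nonneg_right (pow_le_pow_left₀ (abs_nonneg _) (hv j) k)
          (softmaxWeight_nonneg β z j)
    _ = r ^ k := by rw [← mul_sum, sum_softmaxWeight, mul_one]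

lemma hasDerivAt_exp_line (β : ℝ) (v z : Fin p → ℝ) (j : Fin p) (s : ℝ) :
    HasDerivAt (fun s => Real.exp (β * (z j + s * v j)))
      (β * v j * Real.exp (β * (z j + s * v j))) s := by
  have h : HasDerivAt (fun s : ℝ => β * (z j + s * v j)) (β * (1 * v j)) s :=
    (((hasDerivAt_id s).mul_const (v j)).const_add (z j)).const_mul β
  convert! h.exp using 1
  ring

lemma hasDerivAt_sum_exp_line (β : ℝ) (v z : Fin p → ℝ) (k : ℕ) (s : ℝ) :
    HasDerivAt (fun s => ∑ j, v j ^ k * Real.exp (β * (z j + s * v j)))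
      (β * ∑ j, v j ^ (k + 1) * Real.exp (β * (z j + s * v j))) s := by
  rw [mul_sum]
  convert! HasDerivAt.fun_sum fun j (_ : j ∈ univ) =>
    (hasDerivAt_exp_line β v z j s).const_mul (v j ^ k) using 1
  exact sum_congr rfl fun j _ => by ring

lemma softmaxMoment_eq_div (β : ℝ) (v z : Fin p → ℝ) (k : ℕ) :
    softmaxMoment β v z k =
      (∑ j, v j ^ k * Real.exp (β * z j)) / ∑ j, Real.exp (β * z j) := by
  unfold softmaxMoment softmaxWeight
  rw [sum_div]
  exact sum_congr rfl fun j _ => by ring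

lemma hasDerivAt_softmaxMoment_line [NeZero p] (β : ℝ) (v z : Fin p → ℝ) (k : ℕ) (s : ℝ) :
    HasDerivAt (fun s => softmaxMoment β v (fun j => z j + s * v j) k)
      (β * (softmaxMoment β v (fun j => z j + s * v j) (k + 1) -
        softmaxMoment β v (fun j => z j + s * v j) k *
          softmaxMoment β v (fun j => z j + s * v j) 1)) s := by
  simp_rw [softmaxMoment_eq_div]
  have hpos := sum_exp_pos β (fun j => z j + s * v j)
  have h0 : HasDerivAt (fun s => ∑ j, Real.exp (β * (z j + s * v j)))
      (β * ∑ j, v j ^ 1 * Real.exp (β * (z j + s * v j))) s := by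
    simpa using hasDerivAt_sum_exp_line β v z 0 s
  convert! (hasDerivAt_sum_exp_line β v z k s).div h0 hpos.ne' using 1
  field_simp

lemma hasDerivAt_smoothMax_line [NeZero p] {β : ℝ} (hβ : 0 < β) (v z : Fin p → ℝ) (s : ℝ) :
    HasDerivAt (fun s => smoothMax β (fun j => z j + s * v j))
      (softmaxMoment β v (fun j => z j + s * v j) 1) s := by
  unfold smoothMax
  rw [softmaxMoment_eq_div]
  have hpos := sum_exp_pos β (fun j => z j + s * v j)
  have h0 : HasDerivAt (fun s => ∑ j, Real.exp (β * (z j + s * v j)))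
      (β * ∑ j, v j ^ 1 * Real.exp (β * (z j + s * v j))) s := by
    simpa using hasDerivAt_sum_exp_line β v z 0 s
  convert! (h0.log hpos.ne').const_mul β⁻¹ using 1
  rw [mul_div_assoc, inv_mul_cancel_left₀ hβ.ne']

/-- The second order Taylor expansion on `[0, 1]`, with a crude constant. -/
lemma abs_taylor_two_le {f f₁ f₂ f₃ : ℝ → ℝ} (h₁ : ∀ s, HasDerivAt f (f₁ s) s)
    (h₂ : ∀ s, HasDerivAt f₁ (f₂ s) s) (h₃ : ∀ s, HasDerivAt f₂ (f₃ s) s) {K : ℝ}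
    (hK : ∀ s, |f₃ s| ≤ K) : |f 1 - f 0 - f₁ 0 - f₂ 0 / 2| ≤ K := by
  have key : ∀ {g g' : ℝ → ℝ}, (∀ s, HasDerivAt g (g' s) s) →
      (∀ s ∈ Set.Icc (0 : ℝ) 1, |g' s| ≤ K) → ∀ s ∈ Set.Icc (0 : ℝ) 1, |g s - g 0| ≤ K := by
    intro g g' hg hg' s hs
    have hK0 : 0 ≤ K := (abs_nonneg _).trans (hK 0)
    have := norm_image_sub_le_of_norm_deriv_le_segment' (f := g) (f' := g') (a := 0) (b := 1)
      (C := K) (fun x _ => (hg x).hasDerivWithinAt)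
      (fun x hx => hg' x (Set.Ico_subset_Icc_self hx)) s hs
    rw [Real.norm_eq_abs, sub_zero] at this
    nlinarith [hs.1, hs.2]
  have e2 := key h₃ fun s _ => hK s
  have e1 := key (g := fun s => f₁ s - s * f₂ 0) (g' := fun s => f₂ s - f₂ 0)
    (fun s => by
      convert! (h₂ s).sub ((hasDerivAt_id s).mul_const (f₂ 0)) using 1
      simp) e2
  have e0 := key (g := fun s => f s - s * f₁ 0 - s ^ 2 / 2 * f₂ 0)
    (g' := fun s => f₁ s - f₁ 0 - s * f₂ 0)
    (fun s => by
      have := ((h₁ s).sub ((hasDerivAt_id s).mul_const (f₁ 0))).sub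
        (((hasDerivAt_pow 2 s).div_const 2).mul_const (f₂ 0))
      convert! this using 1
      simp) (fun s hs => by
      have := e1 s hs
      simp only [zero_mul, sub_zero] at this
      rwa [sub_right_comm] at this) 1 (by simp)
  simp only [one_mul, one_pow, zero_mul, sub_zero] at e0
  convert e0 using 2
  ring

/-- A real function with three derivatives, recorded together with sup-norm bounds on them. -/
structure SmoothStep (ψ ψ₁ ψ₂ ψ₃ : ℝ → ℝ) (A₁ A₂ A₃ : ℝ) : Prop where
  deriv₁ : ∀ x, HasDerivAt ψ (ψ₁ x) x
  deriv₂ : ∀ x, HasDerivAt ψ₁ (ψ₂ x) x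
  deriv₃ : ∀ x, HasDerivAt ψ₂ (ψ₃ x) x
  bound₁ : ∀ x, |ψ₁ x| ≤ A₁
  bound₂ : ∀ x, |ψ₂ x| ≤ A₂
  bound₃ : ∀ x, |ψ₃ x| ≤ A₃

/-- The gradient of `z ↦ ψ (a * smoothMax β z + b)`, where `ψ₁ = ψ'`. -/
noncomputable def stepGrad (ψ₁ : ℝ → ℝ) (a b β : ℝ) (z : Fin p → ℝ) (j : Fin p) : ℝ :=
  a * ψ₁ (a * smoothMax β z + b) * softmaxWeight β z j

/-- The Hessian of `z ↦ ψ (a * smoothMax β z + b)`, where `ψ₁ = ψ'` and `ψ₂ = ψ''`. -/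
noncomputable def stepHess (ψ₁ ψ₂ : ℝ → ℝ) (a b β : ℝ) (z : Fin p → ℝ) (j k : Fin p) : ℝ :=
  a ^ 2 * ψ₂ (a * smoothMax β z + b) * (softmaxWeight β z j * softmaxWeight β z k) +
    a * β * ψ₁ (a * smoothMax β z + b) *
      ((if j = k then softmaxWeight β z j else 0) - softmaxWeight β z j * softmaxWeight β z k)

variable {ψ ψ₁ ψ₂ ψ₃ : ℝ → ℝ} {A₁ A₂ A₃ : ℝ}

lemma sum_sum_mul_ite_eq (w v : Fin p → ℝ) :
    ∑ j, ∑ k, (if j = k then w j else 0) * (v j * v k) = ∑ j, v j ^ 2 * w j := by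
  refine sum_congr rfl fun j _ => ?_
  simp only [ite_mul, zero_mul, sum_ite_eq, mem_univ, if_true]
  ring

lemma sum_sum_mul_mul_eq (w v : Fin p → ℝ) :
    ∑ j, ∑ k, (w j * w k) * (v j * v k) = (∑ j, v j ^ 1 * w j) ^ 2 := by
  rw [sq, sum_mul_sum]
  exact sum_congr rfl fun j _ => sum_congr rfl fun k _ => by ring

lemma sum_sum_stepHess_mul (a b β : ℝ) (z v : Fin p → ℝ) :
    ∑ j, ∑ k, stepHess ψ₁ ψ₂ a b β z j k * (v j * v k) =
      a ^ 2 * ψ₂ (a * smoothMax β z + b) * softmaxMoment β v z 1 ^ 2 +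
        a * β * ψ₁ (a * smoothMax β z + b) *
          (softmaxMoment β v z 2 - softmaxMoment β v z 1 ^ 2) := by
  unfold softmaxMoment
  rw [← sum_sum_mul_ite_eq, ← sum_sum_mul_mul_eq]
  simp only [mul_sum, ← sum_sub_distrib, ← sum_add_distrib, mul_sub]
  refine sum_congr rfl fun j _ => sum_congr rfl fun k _ => ?_
  unfold stepHess
  ring

lemma sum_sum_abs_stepHess_le [NeZero p] (hψ : SmoothStep ψ ψ₁ ψ₂ ψ₃ A₁ A₂ A₃) {a b β : ℝ}
    (ha : 0 ≤ a) (hβ : 0 ≤ β) (z : Fin p → ℝ) :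
    ∑ j, ∑ k, |stepHess ψ₁ ψ₂ a b β z j k| ≤ a ^ 2 * A₂ + 2 * (a * β * A₁) := by
  set w := softmaxWeight β z with hw
  have hw0 : ∀ j, 0 ≤ w j := softmaxWeight_nonneg β z
  have hA₁ : 0 ≤ A₁ := (abs_nonneg _).trans (hψ.bound₁ 0)
  have hA₂ : 0 ≤ A₂ := (abs_nonneg _).trans (hψ.bound₂ 0)
  have hterm : ∀ j k, |stepHess ψ₁ ψ₂ a b β z j k| ≤
      a ^ 2 * A₂ * (w j * w k) + a * β * A₁ * ((if j = k then w j else 0) + w j * w k) := by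
    intro j k
    have hjk : 0 ≤ w j * w k := mul_nonneg (hw0 j) (hw0 k)
    unfold stepHess
    refine (abs_add_le _ _).trans (add_le_add ?_ ?_)
    · rw [abs_mul, abs_mul, abs_of_nonneg (sq_nonneg a), abs_of_nonneg hjk]
      exact mul_le_mul_of_nonneg_right
        (mul_le_mul_of_nonneg_left (hψ.bound₂ _) (sq_nonneg a)) hjk
    · rw [abs_mul, abs_mul, abs_of_nonneg (mul_nonneg ha hβ)]
      refine mul_le_mul (mul_le_mul_of_nonneg_left (hψ.bound₁ _) (mul_nonneg ha hβ)) ?_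
        (abs_nonneg _) (mul_nonneg (mul_nonneg ha hβ) hA₁)
      refine (abs_sub _ _).trans ?_
      rw [abs_of_nonneg hjk]
      gcongr
      split_ifs
      · rw [abs_of_nonneg (hw0 j)]
      · simp
  have hs : ∑ j, w j = 1 := sum_softmaxWeight β z
  calc ∑ j, ∑ k, |stepHess ψ₁ ψ₂ a b β z j k|
      ≤ ∑ j, ∑ k, (a ^ 2 * A₂ * (w j * w k) +
          a * β * A₁ * ((if j = k then w j else 0) + w j * w k)) :=
        sum_le_sum fun j _ => sum_le_sum fun k _ => hterm j k
    _ = a ^ 2 * A₂ + 2 * (a * β * A₁) := by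
        simp only [sum_add_distrib, ← mul_sum, sum_ite_eq, mem_univ, if_true, hs, mul_one]
        ring

/-- Second order Taylor expansion of `z ↦ ψ (a * smoothMax β z + b)` with a remainder that is
cubic in the sup norm of the increment, uniformly in `z`. -/
lemma abs_step_taylor_le [NeZero p] (hψ : SmoothStep ψ ψ₁ ψ₂ ψ₃ A₁ A₂ A₃) {a b β : ℝ}
    (ha : 0 ≤ a) (hβ : 0 < β) (z : Fin p → ℝ) {v : Fin p → ℝ} {r : ℝ} (hr : 0 ≤ r)
    (hv : ∀ j, |v j| ≤ r) :
    |ψ (a * smoothMax β (fun j => z j + v j) + b) - ψ (a * smoothMax β z + b) -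
        ∑ j, stepGrad ψ₁ a b β z j * v j -
        (∑ j, ∑ k, stepHess ψ₁ ψ₂ a b β z j k * (v j * v k)) / 2| ≤
      (a ^ 3 * A₃ + 6 * (a ^ 2 * β * A₂) + 6 * (a * β ^ 2 * A₁)) * r ^ 3 := by
  set u : ℝ → ℝ := fun s => a * smoothMax β (fun j => z j + s * v j) + b with hu
  set M : ℕ → ℝ → ℝ := fun k s => softmaxMoment β v (fun j => z j + s * v j) k with hM
  have hu' : ∀ s, HasDerivAt u (a * M 1 s) s := fun s =>
    ((hasDerivAt_smoothMax_line hβ v z s).const_mul a).add_const b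
  have hM' : ∀ k s, HasDerivAt (M k) (β * (M (k + 1) s - M k s * M 1 s)) s := fun k s =>
    hasDerivAt_softmaxMoment_line β v z k s
  have hMb : ∀ k s, |M k s| ≤ r ^ k := fun k s => abs_softmaxMoment_le β hv _ k
  have hA₁ : 0 ≤ A₁ := (abs_nonneg _).trans (hψ.bound₁ 0)
  have hA₂ : 0 ≤ A₂ := (abs_nonneg _).trans (hψ.bound₂ 0)
  have hA₃ : 0 ≤ A₃ := (abs_nonneg _).trans (hψ.bound₃ 0)
  have h₁ : ∀ s, HasDerivAt (fun s => ψ (u s)) (a * ψ₁ (u s) * M 1 s) s := fun s => by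
    convert! (hψ.deriv₁ (u s)).comp s (hu' s) using 1
    ring
  have h₂ : ∀ s, HasDerivAt (fun s => a * ψ₁ (u s) * M 1 s)
      (a ^ 2 * ψ₂ (u s) * M 1 s ^ 2 + a * β * ψ₁ (u s) * (M 2 s - M 1 s ^ 2)) s := fun s => by
    convert! ((((hψ.deriv₂ (u s)).comp s (hu' s)).const_mul a).mul (hM' 1 s)) using 1
    simp only [Function.comp]
    ring
  have h₃ : ∀ s, HasDerivAt
      (fun s => a ^ 2 * ψ₂ (u s) * M 1 s ^ 2 + a * β * ψ₁ (u s) * (M 2 s - M 1 s ^ 2))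
      (a ^ 3 * ψ₃ (u s) * M 1 s ^ 3 +
        3 * (a ^ 2 * β * ψ₂ (u s)) * (M 1 s * (M 2 s - M 1 s ^ 2)) +
        a * β ^ 2 * ψ₁ (u s) * (M 3 s - 3 * (M 2 s * M 1 s) + 2 * M 1 s ^ 3)) s := fun s => by
    have e1 := (((hψ.deriv₃ (u s)).comp s (hu' s)).const_mul (a ^ 2)).mul ((hM' 1 s).pow 2)
    have e2 := (((hψ.deriv₂ (u s)).comp s (hu' s)).const_mul (a * β)).mul
      ((hM' 2 s).sub ((hM' 1 s).pow 2))
    convert! e1.add e2 using 1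
    simp only [Function.comp, Pi.pow_apply, Pi.sub_apply]
    push_cast
    ring
  have hK : ∀ s, |a ^ 3 * ψ₃ (u s) * M 1 s ^ 3 +
        3 * (a ^ 2 * β * ψ₂ (u s)) * (M 1 s * (M 2 s - M 1 s ^ 2)) +
        a * β ^ 2 * ψ₁ (u s) * (M 3 s - 3 * (M 2 s * M 1 s) + 2 * M 1 s ^ 3)| ≤
      (a ^ 3 * A₃ + 6 * (a ^ 2 * β * A₂) + 6 * (a * β ^ 2 * A₁)) * r ^ 3 := fun s => by
    have m1 : |M 1 s| ≤ r := by simpa using hMb 1 s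
    have m2 := hMb 2 s
    have m3 := hMb 3 s
    have c1 : |M 1 s ^ 3| ≤ r ^ 3 := by
      rw [abs_pow]
      exact pow_le_pow_left₀ (abs_nonneg _) m1 3
    have c0 : |M 1 s ^ 2| ≤ r ^ 2 := by
      rw [abs_pow]
      exact pow_le_pow_left₀ (abs_nonneg _) m1 2
    have c2 : |M 1 s * (M 2 s - M 1 s ^ 2)| ≤ 2 * r ^ 3 := by
      rw [abs_mul]
      calc |M 1 s| * |M 2 s - M 1 s ^ 2| ≤ r * (r ^ 2 + r ^ 2) :=
            mul_le_mul m1 ((abs_sub _ _).trans (add_le_add m2 c0)) (abs_nonneg _) hr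
        _ = 2 * r ^ 3 := by ring
    have c4 : |M 2 s * M 1 s| ≤ r ^ 3 := by
      rw [abs_mul]
      calc |M 2 s| * |M 1 s| ≤ r ^ 2 * r := mul_le_mul m2 m1 (abs_nonneg _) (by positivity)
        _ = r ^ 3 := by ring
    have c3 : |M 3 s - 3 * (M 2 s * M 1 s) + 2 * M 1 s ^ 3| ≤ 6 * r ^ 3 := by
      rw [abs_le] at c1 c4 m3 ⊢
      constructor <;> linarith [c1.1, c1.2, c4.1, c4.2, m3.1, m3.2]
    have d1 : |a ^ 3 * ψ₃ (u s) * M 1 s ^ 3| ≤ a ^ 3 * A₃ * r ^ 3 := by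
      rw [abs_mul, abs_mul, abs_of_nonneg (pow_nonneg ha 3)]
      gcongr
      exact hψ.bound₃ _
    have d2 : |3 * (a ^ 2 * β * ψ₂ (u s)) * (M 1 s * (M 2 s - M 1 s ^ 2))| ≤
        3 * (a ^ 2 * β * A₂) * (2 * r ^ 3) := by
      have hn : 0 ≤ a ^ 2 * β := by positivity
      rw [abs_mul, abs_mul 3, abs_mul (a ^ 2 * β), abs_of_nonneg hn, abs_of_pos three_pos]
      gcongr
      exact hψ.bound₂ _
    have d3 : |a * β ^ 2 * ψ₁ (u s) * (M 3 s - 3 * (M 2 s * M 1 s) + 2 * M 1 s ^ 3)| ≤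
        a * β ^ 2 * A₁ * (6 * r ^ 3) := by
      have hn : 0 ≤ a * β ^ 2 := by positivity
      rw [abs_mul, abs_mul (a * β ^ 2), abs_of_nonneg hn]
      gcongr
      exact hψ.bound₁ _
    refine (abs_add_three _ _ _).trans ?_
    linarith
  have key := abs_taylor_two_le h₁ h₂ h₃ hK
  have hz : (fun j => z j + 0 * v j) = z := by ext; simp
  have hz1 : (fun j => z j + 1 * v j) = fun j => z j + v j := by ext; simp
  have hgrad : ∑ j, stepGrad ψ₁ a b β z j * v j =
      a * ψ₁ (a * smoothMax β z + b) * softmaxMoment β v z 1 := by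
    unfold stepGrad softmaxMoment
    rw [mul_sum]
    exact sum_congr rfl fun j _ => by ring
  simp only [hu, hM, hz, hz1] at key
  rw [hgrad, sum_sum_stepHess_mul]
  exact key

lemma maxCoord_le_iff [NeZero p] {v : Fin p → ℝ} {t : ℝ} : maxCoord v ≤ t ↔ ∀ j, v j ≤ t :=
  ciSup_le_iff (Set.finite_range v).bddAbove

lemma le_maxCoord [NeZero p] (v : Fin p → ℝ) (j : Fin p) : v j ≤ maxCoord v :=
  maxCoord_le_iff.1 le_rfl j

lemma maxCoord_le_smoothMax [NeZero p] {β : ℝ} (hβ : 0 < β) (z : Fin p → ℝ) :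
    maxCoord z ≤ smoothMax β z := by
  refine maxCoord_le_iff.2 fun j => ?_
  unfold smoothMax
  rw [inv_mul_eq_div, le_div_iff₀ hβ, mul_comm, Real.le_log_iff_exp_le (sum_exp_pos β z)]
  exact single_le_sum (f := fun j => Real.exp (β * z j)) (fun _ _ => (Real.exp_pos _).le)
    (mem_univ j)

lemma smoothMax_le [NeZero p] {β : ℝ} (hβ : 0 < β) (z : Fin p → ℝ) :
    smoothMax β z ≤ maxCoord z + Real.log p / β := by
  have hp : (0 : ℝ) < p := by exact_mod_cast Nat.pos_of_neZero p
  unfold smoothMax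
  rw [inv_mul_eq_div, div_le_iff₀ hβ, add_mul, div_mul_cancel₀ _ hβ.ne',
    Real.log_le_iff_le_exp (sum_exp_pos β z), Real.exp_add, Real.exp_log hp]
  calc ∑ j, Real.exp (β * z j) ≤ ∑ _j : Fin p, Real.exp (maxCoord z * β) := by
        refine sum_le_sum fun j _ => Real.exp_le_exp.2 ?_
        rw [mul_comm]
        exact mul_le_mul_of_nonneg_right (le_maxCoord z j) hβ.le
    _ = Real.exp (maxCoord z * β) * p := by simp [mul_comm]

/-- The standard smooth transition function and its first three derivatives. -/
lemma exists_smoothStep : ∃ (ψ₁ ψ₂ ψ₃ : ℝ → ℝ) (A : ℝ),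
    SmoothStep Real.smoothTransition ψ₁ ψ₂ ψ₃ A A A := by
  have hψ : ContDiff ℝ 3 Real.smoothTransition :=
    Real.smoothTransition.contDiff (n := ((3 : ℕ∞)))
  -- The derivatives are continuous and vanish outside `[0, 1]`, hence bounded.
  have hb : ∀ k, 1 ≤ k → k ≤ 3 → ∃ A, ∀ x, |iteratedDeriv k Real.smoothTransition x| ≤ A := by
    intro k hk1 hk
    have hc : Continuous (iteratedDeriv k Real.smoothTransition) :=
      hψ.continuous_iteratedDeriv k (by exact_mod_cast hk)
    obtain ⟨A, hA⟩ := isCompact_Icc (a := (0 : ℝ)) (b := 1) |>.exists_bound_of_continuousOn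
      hc.continuousOn
    refine ⟨A, fun x => ?_⟩
    by_cases hx : x ∈ Set.Icc (0 : ℝ) 1
    · exact hA x hx
    have h0 : iteratedDeriv k Real.smoothTransition x = 0 := by
      obtain ⟨c, hc⟩ : ∃ c, Real.smoothTransition =ᶠ[nhds x] fun _ => c := by
        rcases not_and_or.1 hx with h | h
        · refine ⟨0, ?_⟩
          filter_upwards [Iio_mem_nhds (not_le.1 h)] with y hy
          exact Real.smoothTransition.zero_of_nonpos (le_of_lt hy)
        · refine ⟨1, ?_⟩
          filter_upwards [Ioi_mem_nhds (not_le.1 h)] with y hy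
          exact Real.smoothTransition.one_of_one_le (le_of_lt hy)
      rw [hc.iteratedDeriv_eq k, iteratedDeriv_const, if_neg (by omega)]
    rw [h0, abs_zero]
    exact (norm_nonneg _).trans (hA 0 (by simp))
  have hd : ∀ k, k < 3 → ∀ x, HasDerivAt (iteratedDeriv k Real.smoothTransition)
      (iteratedDeriv (k + 1) Real.smoothTransition x) x := by
    intro k hk x
    rw [iteratedDeriv_succ]
    exact (hψ.differentiable_iteratedDeriv k (by exact_mod_cast hk) x).hasDerivAt
  obtain ⟨A₁, h₁⟩ := hb 1 (by norm_num) (by norm_num)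
  obtain ⟨A₂, h₂⟩ := hb 2 (by norm_num) (by norm_num)
  obtain ⟨A₃, h₃⟩ := hb 3 (by norm_num) (by norm_num)
  refine ⟨_, _, _, max A₁ (max A₂ A₃), ⟨fun x => ?_, hd 1 (by norm_num), hd 2 (by norm_num),
    fun x => (h₁ x).trans (le_max_left _ _),
    fun x => (h₂ x).trans ((le_max_left _ _).trans (le_max_right _ _)),
    fun x => (h₃ x).trans ((le_max_right _ _).trans (le_max_right _ _))⟩⟩
  simpa using hd 0 (by norm_num) x

end SmoothMax

/-! ### Replacing one Gaussian measure by another -/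

section Lindeberg

open Finset Filter Topology

variable {p : ℕ}

/-- The function `h` has at every point a second order Taylor expansion whose remainder is at most
`K ‖v‖³` and whose Hessian has entrywise `ℓ¹` norm at most `L`. -/
def HasTaylorTwo (h : EuclideanSpace ℝ (Fin p) → ℝ) (L K : ℝ) : Prop :=
  ∀ z, ∃ (D : Fin p → ℝ) (H : Fin p → Fin p → ℝ), ∑ j, ∑ k, |H j k| ≤ L ∧
    ∀ v, |h (z + v) - h z - ∑ j, D j * v j - (∑ j, ∑ k, H j k * (v j * v k)) / 2| ≤ K * ‖v‖ ^ 3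

lemma integrable_of_abs_le {E : Type*} [MeasurableSpace E] {μ : Measure E} [IsFiniteMeasure μ]
    {h : E → ℝ} (hm : Measurable h) {B : ℝ} (hB : ∀ x, |h x| ≤ B) : Integrable h μ :=
  Integrable.of_bound hm.aestronglyMeasurable B (ae_of_all _ hB)

/-- A centered Gaussian increment changes the mean of `h` by half the contraction of the Hessian
with the covariance, up to the third moment of the increment. -/
lemma abs_integral_add_sub_le {h : EuclideanSpace ℝ (Fin p) → ℝ} (hm : Measurable h) {B : ℝ}
    (hB : ∀ x, |h x| ≤ B) {K : ℝ} {z : EuclideanSpace ℝ (Fin p)} {D : Fin p → ℝ}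
    {H : Fin p → Fin p → ℝ}
    (hT : ∀ v : EuclideanSpace ℝ (Fin p),
      |h (z + v) - h z - ∑ j, D j * v j - (∑ j, ∑ k, H j k * (v j * v k)) / 2| ≤ K * ‖v‖ ^ 3)
    {S : Matrix (Fin p) (Fin p) ℝ} (hS : S.PosSemidef) :
    |∫ v, h (z + v) ∂(multivariateGaussian 0 S) - h z - (∑ j, ∑ k, H j k * S j k) / 2| ≤
      K * ∫ v, ‖v‖ ^ 3 ∂(multivariateGaussian 0 S) := by
  set γ := multivariateGaussian 0 S with hγ
  have i1 : Integrable (fun v => h (z + v)) γ :=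
    integrable_of_abs_le (hm.comp (measurable_const_add z)) fun x => hB _
  have i2 : ∀ j, Integrable (fun v : EuclideanSpace ℝ (Fin p) => D j * v j) γ := fun j =>
    ((memLp_coord_centeredGaussian S j).integrable (by norm_num)).const_mul _
  have i3 : ∀ j k, Integrable (fun v : EuclideanSpace ℝ (Fin p) => H j k * (v j * v k)) γ :=
    fun j k => ((memLp_coord_centeredGaussian S j).integrable_mul
      (memLp_coord_centeredGaussian S k)).const_mul _
  have i4 : Integrable (fun v : EuclideanSpace ℝ (Fin p) => ∑ j, D j * v j) γ :=
    integrable_finsetSum _ fun j _ => i2 j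
  have i5 : Integrable (fun v : EuclideanSpace ℝ (Fin p) =>
      (∑ j, ∑ k, H j k * (v j * v k)) / 2) γ :=
    (integrable_finsetSum _ fun j _ => integrable_finsetSum _ fun k _ => i3 j k).div_const 2
  have e4 : ∫ v, ∑ j, D j * v j ∂γ = 0 := by
    rw [integral_finsetSum _ fun j _ => i2 j]
    refine sum_eq_zero fun j _ => ?_
    rw [integral_const_mul, hγ, integral_coord_centeredGaussian, mul_zero]
  have e5 : ∫ v, (∑ j, ∑ k, H j k * (v j * v k)) / 2 ∂γ = (∑ j, ∑ k, H j k * S j k) / 2 := by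
    rw [integral_div, integral_finsetSum _ fun j _ => integrable_finsetSum _ fun k _ => i3 j k]
    congr 1
    refine sum_congr rfl fun j _ => ?_
    rw [integral_finsetSum _ fun k _ => i3 j k]
    refine sum_congr rfl fun k _ => ?_
    rw [integral_const_mul, hγ, integral_coord_mul_coord_centeredGaussian hS]
  have e : ∫ v, (h (z + v) - h z - ∑ j, D j * v j - (∑ j, ∑ k, H j k * (v j * v k)) / 2) ∂γ =
      ∫ v, h (z + v) ∂γ - h z - (∑ j, ∑ k, H j k * S j k) / 2 := by
    have i6 : Integrable (fun v => h (z + v) - h z) γ := i1.sub (integrable_const _)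
    have i7 : Integrable (fun v => h (z + v) - h z - ∑ j, D j * v j) γ := i6.sub i4
    rw [integral_sub i7 i5, integral_sub i6 i4, integral_sub i1 (integrable_const _), e4, e5]
    simp
  rw [← e, ← integral_const_mul, ← Real.norm_eq_abs]
  exact norm_integral_le_of_norm_le ((integrable_norm_pow_three_centeredGaussian S).const_mul K)
    (ae_of_all _ hT)

/-- Exchanging one independent Gaussian summand for another. -/
lemma abs_integral_conv_sub_le {h : EuclideanSpace ℝ (Fin p) → ℝ} (hm : Measurable h) {B : ℝ}
    (hB : ∀ x, |h x| ≤ B) {L K : ℝ} (hT : HasTaylorTwo h L K)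
    {S S' : Matrix (Fin p) (Fin p) ℝ} (hS : S.PosSemidef) (hS' : S'.PosSemidef) {Δ : ℝ}
    (hΔ : ∀ j k, |S j k - S' j k| ≤ Δ) (hΔ0 : 0 ≤ Δ) (μ : Measure (EuclideanSpace ℝ (Fin p)))
    [IsProbabilityMeasure μ] :
    |∫ x, h x ∂(μ ∗ multivariateGaussian 0 S) - ∫ x, h x ∂(μ ∗ multivariateGaussian 0 S')| ≤
      L * Δ / 2 + K * (∫ v, ‖v‖ ^ 3 ∂(multivariateGaussian 0 S) +
        ∫ v, ‖v‖ ^ 3 ∂(multivariateGaussian 0 S')) := by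
  have hpt : ∀ z, |∫ v, h (z + v) ∂(multivariateGaussian 0 S) -
      ∫ v, h (z + v) ∂(multivariateGaussian 0 S')| ≤
      L * Δ / 2 + K * (∫ v, ‖v‖ ^ 3 ∂(multivariateGaussian 0 S) +
        ∫ v, ‖v‖ ^ 3 ∂(multivariateGaussian 0 S')) := by
    intro z
    obtain ⟨D, H, hL, hR⟩ := hT z
    have a1 := abs_integral_add_sub_le hm hB hR hS
    have a2 := abs_integral_add_sub_le hm hB hR hS'
    have a3 : |∑ j, ∑ k, H j k * S j k - ∑ j, ∑ k, H j k * S' j k| ≤ L * Δ := by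
      simp only [← sum_sub_distrib, ← mul_sub]
      calc |∑ j, ∑ k, H j k * (S j k - S' j k)|
          ≤ ∑ j, |∑ k, H j k * (S j k - S' j k)| := abs_sum_le_sum_abs _ _
        _ ≤ ∑ j, ∑ k, |H j k * (S j k - S' j k)| :=
            sum_le_sum fun j _ => abs_sum_le_sum_abs _ _
        _ ≤ ∑ j, ∑ k, |H j k| * Δ := by
            refine sum_le_sum fun j _ => sum_le_sum fun k _ => ?_
            rw [abs_mul]
            exact mul_le_mul_of_nonneg_left (hΔ j k) (abs_nonneg _)
        _ ≤ L * Δ := by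
            simp only [← sum_mul]
            exact mul_le_mul_of_nonneg_right hL hΔ0
    rw [abs_le] at a1 a2 a3 ⊢
    constructor <;> linarith [a1.1, a1.2, a2.1, a2.2, a3.1, a3.2]
  have hmeas : ∀ ν : Measure (EuclideanSpace ℝ (Fin p)), IsProbabilityMeasure ν →
      Integrable (fun z => ∫ v, h (z + v) ∂ν) μ := by
    intro ν _
    exact Integrable.integral_prod_left (f := fun q : _ × _ => h (q.1 + q.2))
      (integrable_of_abs_le (hm.comp (by fun_prop)) fun x => hB _)
  rw [integral_conv (integrable_of_abs_le hm hB), integral_conv (integrable_of_abs_le hm hB),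
    ← integral_sub (hmeas _ inferInstance) (hmeas _ inferInstance), ← Real.norm_eq_abs]
  refine (norm_integral_le_of_norm_le_const (ae_of_all _ hpt)).trans ?_
  simp

lemma integral_norm_pow_three_smul {S : Matrix (Fin p) (Fin p) ℝ} (hS : S.PosSemidef) {c : ℝ}
    (hc : 0 ≤ c) : ∫ v, ‖v‖ ^ 3 ∂(multivariateGaussian 0 (c ^ 2 • S)) =
      c ^ 3 * ∫ v, ‖v‖ ^ 3 ∂(multivariateGaussian 0 S) := by
  rw [← map_smul_centeredGaussian hS, integral_map (by fun_prop) (by fun_prop),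
    ← integral_const_mul]
  simp_rw [norm_smul, Real.norm_of_nonneg hc, mul_pow]

/-- Centered Gaussian measures whose covariance matrices are entrywise within `Δ` give means of `h`
within `L Δ / 2`. Both measures are cut into `q²` independent pieces, exchanged one at a time; the
total third-moment error is of order `1 / q`. -/
theorem abs_integral_gaussian_sub_le {h : EuclideanSpace ℝ (Fin p) → ℝ} (hm : Measurable h) {B : ℝ}
    (hB : ∀ x, |h x| ≤ B) {L K : ℝ} (hT : HasTaylorTwo h L K)
    {S S' : Matrix (Fin p) (Fin p) ℝ} (hS : S.PosSemidef) (hS' : S'.PosSemidef) {Δ : ℝ}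
    (hΔ : ∀ j k, |S j k - S' j k| ≤ Δ) (hΔ0 : 0 ≤ Δ) :
    |∫ x, h x ∂(multivariateGaussian 0 S) - ∫ x, h x ∂(multivariateGaussian 0 S')| ≤
      L * Δ / 2 := by
  set M := ∫ v, ‖v‖ ^ 3 ∂(multivariateGaussian 0 S) +
    ∫ v, ‖v‖ ^ 3 ∂(multivariateGaussian 0 S') with hM
  have hq : ∀ q : ℕ, 0 < q →
      |∫ x, h x ∂(multivariateGaussian 0 S) - ∫ x, h x ∂(multivariateGaussian 0 S')| ≤
        L * Δ / 2 + K * M * (1 / (q : ℝ)) := by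
    intro q hq0
    have hq1 : (0 : ℝ) < q := by exact_mod_cast hq0
    set c : ℝ := 1 / q with hc
    have hc0 : 0 ≤ c := by positivity
    have hcq : (q : ℝ) ^ 2 * c ^ 2 = 1 := by
      rw [hc]
      field_simp
    set T : ℕ → Matrix (Fin p) (Fin p) ℝ := fun m =>
      (m * c ^ 2) • S + (((q ^ 2 : ℕ) - m : ℝ) * c ^ 2) • S' with hTdef
    set J : ℕ → ℝ := fun m => ∫ x, h x ∂(multivariateGaussian 0 (T m)) with hJ
    have hstep : ∀ m ∈ range (q ^ 2), |J (m + 1) - J m| ≤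
        c ^ 2 * (L * Δ / 2) + K * (c ^ 3 * M) := by
      intro m hmq
      have hmq' : ((m : ℝ) + 1) ≤ ((q ^ 2 : ℕ) : ℝ) := by exact_mod_cast mem_range.1 hmq
      set V := (m * c ^ 2) • S + (((q ^ 2 : ℕ) - (m + 1) : ℝ) * c ^ 2) • S' with hV
      have hVp : V.PosSemidef := (hS.smul (by positivity)).add
        (hS'.smul (mul_nonneg (by linarith) (by positivity)))
      have hcS := hS.smul (sq_nonneg c)
      have hcS' := hS'.smul (sq_nonneg c)
      have t1 : T (m + 1) = V + c ^ 2 • S := by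
        simp only [hV, hTdef]
        push_cast
        module
      have t2 : T m = V + c ^ 2 • S' := by
        simp only [hV, hTdef]
        module
      have key := abs_integral_conv_sub_le hm hB hT hcS hcS' (Δ := c ^ 2 * Δ) (fun j k => by
        rw [Matrix.smul_apply, Matrix.smul_apply, ← smul_sub, smul_eq_mul, abs_mul,
          abs_of_nonneg (sq_nonneg c)]
        exact mul_le_mul_of_nonneg_left (hΔ j k) (sq_nonneg c)) (by positivity)
        (multivariateGaussian 0 V)
      rw [conv_centeredGaussian hVp hcS, conv_centeredGaussian hVp hcS', ← t1, ← t2,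
        integral_norm_pow_three_smul hS hc0, integral_norm_pow_three_smul hS' hc0] at key
      refine key.trans (le_of_eq ?_)
      rw [hM]
      ring
    have hsum : |J (q ^ 2) - J 0| ≤ (q ^ 2 : ℕ) * (c ^ 2 * (L * Δ / 2) + K * (c ^ 3 * M)) := by
      rw [← sum_range_sub J]
      refine (abs_sum_le_sum_abs _ _).trans ((sum_le_sum hstep).trans (le_of_eq ?_))
      rw [sum_const, card_range, nsmul_eq_mul]
    have hT1 : T (q ^ 2) = S := by
      simp only [hTdef, sub_self, zero_mul, zero_smul, add_zero]
      push_cast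
      rw [hcq, one_smul]
    have hT0 : T 0 = S' := by
      simp only [hTdef, Nat.cast_zero, zero_mul, zero_smul, zero_add, sub_zero]
      push_cast
      rw [hcq, one_smul]
    simp only [hJ, hT1, hT0] at hsum
    refine hsum.trans (le_of_eq ?_)
    push_cast
    linear_combination (L * Δ / 2 + K * M * c) * hcq
  have hlim : Tendsto (fun q : ℕ => L * Δ / 2 + K * M * (1 / (q : ℝ))) atTop
      (𝓝 (L * Δ / 2 + K * M * 0)) :=
    (tendsto_one_div_atTop_nhds_zero_nat.const_mul _).const_add _
  rw [mul_zero, add_zero] at hlim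
  refine ge_of_tendsto hlim ?_
  filter_upwards [eventually_gt_atTop 0] with q hq0 using hq q hq0

lemma measurable_smoothMax (β : ℝ) :
    Measurable fun x : EuclideanSpace ℝ (Fin p) => smoothMax β x := by
  unfold smoothMax
  fun_prop

lemma hasTaylorTwo_step [NeZero p] {ψ ψ₁ ψ₂ ψ₃ : ℝ → ℝ} {A₁ A₂ A₃ : ℝ}
    (hψ : SmoothStep ψ ψ₁ ψ₂ ψ₃ A₁ A₂ A₃) {a b β : ℝ} (ha : 0 ≤ a) (hβ : 0 < β) :
    HasTaylorTwo (fun x : EuclideanSpace ℝ (Fin p) => ψ (a * smoothMax β x + b))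
      (a ^ 2 * A₂ + 2 * (a * β * A₁))
      (a ^ 3 * A₃ + 6 * (a ^ 2 * β * A₂) + 6 * (a * β ^ 2 * A₁)) := fun z =>
  ⟨stepGrad ψ₁ a b β z, stepHess ψ₁ ψ₂ a b β z, sum_sum_abs_stepHess_le hψ ha hβ.le z,
    fun v => abs_step_taylor_le hψ ha hβ z (norm_nonneg v) fun j => by
      simpa using PiLp.norm_apply_le v j⟩

end Lindeberg

/-! ### Anti-concentration of Gaussian maxima -/

section AntiConcentration

open Set
open scoped ENNReal

variable {p : ℕ}

/-- The hazard rate of the standard Gaussian measure at `a ≤ A` is at most of order `1 + A`. -/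
lemma gaussianReal_Ioc_le {a A η : ℝ} (haA : a ≤ A) (hA : 0 ≤ A) (hη : 0 < η)
    (hηA : η * (1 + A) ≤ 1) :
    gaussianReal 0 1 (Ioc a (a + η)) ≤
      ENNReal.ofReal (Real.exp 4 * (η * (1 + A))) * gaussianReal 0 1 (Ioi (a + η)) := by
  -- Compare with the mass of an interval of length `d = 1 / (1 + m)` to the right of `m + η`, on
  -- which `x² ≤ (m + 2d)² ≤ m² + 8`, so that the density loses at most a factor `exp (-4)`.
  set m := max a 0 with hm
  have hm0 : 0 ≤ m := le_max_right _ _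
  have hmA : m ≤ A := max_le haA hA
  have ham : a ≤ m := le_max_left _ _
  set d := 1 / (1 + m) with hd
  have hd0 : 0 < d := by positivity
  have hd1 : d * (1 + m) = 1 := by
    rw [hd]
    field_simp
  have hηd : η ≤ d := by
    rw [hd, le_div_iff₀ (by positivity)]
    nlinarith
  set φ : ℝ → ℝ := fun x => (√(2 * Real.pi))⁻¹ * Real.exp (-x ^ 2 / 2) with hφ
  have hpdf : ∀ x, gaussianPDF 0 1 x = ENNReal.ofReal (φ x) := by
    intro x
    simp [gaussianPDF, gaussianPDFReal, hφ]
  have hφ0 : ∀ x, 0 ≤ φ x := fun x => by positivity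
  have hup : gaussianReal 0 1 (Ioc a (a + η)) ≤ ENNReal.ofReal (φ m * η) := by
    rw [gaussianReal_apply 0 one_ne_zero]
    calc ∫⁻ x in Ioc a (a + η), gaussianPDF 0 1 x
        ≤ ∫⁻ _x in Ioc a (a + η), ENNReal.ofReal (φ m) := by
          refine setLIntegral_mono measurable_const fun x hx => ?_
          rw [hpdf]
          refine ENNReal.ofReal_le_ofReal ?_
          have hx2 : m ^ 2 ≤ x ^ 2 := by
            rcases le_total a 0 with h | h
            · rw [hm, max_eq_right h]
              nlinarith
            · rw [hm, max_eq_left h]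
              exact pow_le_pow_left₀ h hx.1.le 2
          simp only [hφ]
          gcongr
      _ = ENNReal.ofReal (φ m * η) := by
          rw [setLIntegral_const, Real.volume_Ioc, add_sub_cancel_left,
            ENNReal.ofReal_mul (hφ0 m)]
  have hlow : ENNReal.ofReal (φ m * Real.exp (-4) * d) ≤ gaussianReal 0 1 (Ioi (a + η)) := by
    have hsub : Ioc (m + η) (m + η + d) ⊆ Ioi (a + η) := fun x hx =>
      lt_of_le_of_lt (by linarith) hx.1
    refine le_trans ?_ (measure_mono hsub)
    rw [gaussianReal_apply 0 one_ne_zero]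
    calc ENNReal.ofReal (φ m * Real.exp (-4) * d)
        = ∫⁻ _x in Ioc (m + η) (m + η + d), ENNReal.ofReal (φ m * Real.exp (-4)) := by
          rw [setLIntegral_const, Real.volume_Ioc, add_sub_cancel_left,
            ENNReal.ofReal_mul (mul_nonneg (hφ0 m) (Real.exp_pos _).le)]
      _ ≤ ∫⁻ x in Ioc (m + η) (m + η + d), gaussianPDF 0 1 x := by
          refine setLIntegral_mono (measurable_gaussianPDF 0 1) fun x hx => ?_
          rw [hpdf]
          refine ENNReal.ofReal_le_ofReal ?_
          have hx0 : 0 ≤ x := by linarith [hx.1]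
          have hx2 : x ^ 2 ≤ m ^ 2 + 8 := by
            have h1 : x ≤ m + 2 * d := by linarith [hx.2]
            have h2 : x ^ 2 ≤ (m + 2 * d) ^ 2 := pow_le_pow_left₀ hx0 h1 2
            have h3 : 0 ≤ m * d := by positivity
            have h4 : d ≤ 1 := by nlinarith
            nlinarith
          simp only [hφ]
          rw [mul_assoc, ← Real.exp_add]
          gcongr
          linarith
  refine hup.trans (le_trans ?_ (mul_le_mul_right hlow _))
  rw [← ENNReal.ofReal_mul (by positivity)]
  refine ENNReal.ofReal_le_ofReal ?_
  have he : Real.exp 4 * Real.exp (-4) = 1 := by rw [← Real.exp_add]; simp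
  have h1 : 1 ≤ (1 + A) * d := by nlinarith
  calc φ m * η ≤ φ m * η * ((1 + A) * d) := le_mul_of_one_le_right
        (mul_nonneg (hφ0 m) hη.le) h1
    _ = Real.exp 4 * (η * (1 + A)) * (φ m * Real.exp (-4) * d) := by
        linear_combination (-(φ m * η * (1 + A) * d)) * he

/-- Comparison of two strips under a product measure, for a set all of whose horizontal sections are
upper sets: as soon as such a section meets `(a, b]`, it contains `(b, ∞)`. -/
lemma prod_inter_Ioc_le {V : Type*} [MeasurableSpace V] {g : Measure ℝ} {ν : Measure V}
    [SFinite g] [SFinite ν] {B : Set (ℝ × V)} (hB : MeasurableSet B)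
    (hup : ∀ u u' v, (u, v) ∈ B → u ≤ u' → (u', v) ∈ B) {a b : ℝ} {R : ℝ≥0∞}
    (hR : g (Ioc a b) ≤ R * g (Ioi b)) :
    g.prod ν (B ∩ Prod.fst ⁻¹' Ioc a b) ≤ R * g.prod ν (B ∩ Prod.fst ⁻¹' Ioi b) := by
  have m1 : MeasurableSet (B ∩ Prod.fst ⁻¹' Ioc a b) := hB.inter (measurable_fst measurableSet_Ioc)
  have m2 : MeasurableSet (B ∩ Prod.fst ⁻¹' Ioi b) := hB.inter (measurable_fst measurableSet_Ioi)
  rw [Measure.prod_apply_symm m1, Measure.prod_apply_symm m2,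
    ← lintegral_const_mul R (measurable_measure_prodMk_right m2)]
  refine lintegral_mono fun v => ?_
  by_cases h : ∃ u ∈ Ioc a b, (u, v) ∈ B
  · obtain ⟨u, hu, huB⟩ := h
    calc g ((fun x => (x, v)) ⁻¹' (B ∩ Prod.fst ⁻¹' Ioc a b)) ≤ g (Ioc a b) :=
          measure_mono fun x hx => hx.2
      _ ≤ R * g (Ioi b) := hR
      _ ≤ R * g ((fun x => (x, v)) ⁻¹' (B ∩ Prod.fst ⁻¹' Ioi b)) := by
          gcongr
          intro x hx
          exact ⟨hup u x v huB (hu.2.trans (le_of_lt hx)), hx⟩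
  · have : (fun x => (x, v)) ⁻¹' (B ∩ Prod.fst ⁻¹' Ioc a b) = ∅ := by
      ext x
      simp only [mem_preimage, mem_inter_iff, mem_empty_iff_false, iff_false, not_and]
      exact fun h1 h2 => h ⟨x, h2, h1⟩
    simp [this]

/-- The event that `j` is the first index at which the standardized coordinate `(y k - t) / σ k`
is largest. Choosing the first index makes the events disjoint even when the coordinates have
ties of positive probability. -/
def firstArgmax (σ : Fin p → ℝ) (t : ℝ) (j : Fin p) : Set (EuclideanSpace ℝ (Fin p)) :=
  {y | ∀ k, (y k - t) / σ k ≤ (y j - t) / σ j ∧ (k < j → (y k - t) / σ k < (y j - t) / σ j)}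

lemma measurableSet_firstArgmax (σ : Fin p → ℝ) (t : ℝ) (j : Fin p) :
    MeasurableSet (firstArgmax σ t j) := by
  have : firstArgmax σ t j = ⋂ k, ({y | (y k - t) / σ k ≤ (y j - t) / σ j} ∩
      {y | k < j → (y k - t) / σ k < (y j - t) / σ j}) := by
    ext y
    simp [firstArgmax]
  rw [this]
  refine MeasurableSet.iInter fun k => (measurableSet_le (by fun_prop) (by fun_prop)).inter ?_
  by_cases h : k < j
  · simpa [h] using measurableSet_lt (f := fun y : EuclideanSpace ℝ (Fin p) => (y k - t) / σ k)
      (g := fun y => (y j - t) / σ j) (by fun_prop) (by fun_prop)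
  · simp [h]

lemma disjoint_firstArgmax (σ : Fin p → ℝ) (t : ℝ) {j k : Fin p} (hjk : j ≠ k) :
    Disjoint (firstArgmax σ t j) (firstArgmax σ t k) := by
  refine disjoint_left.2 fun y hj hk => ?_
  rcases lt_or_gt_of_ne hjk with h | h
  · exact absurd ((hk j).2 h) (not_lt.2 (hj k).1)
  · exact absurd ((hj k).2 h) (not_lt.2 (hk j).1)

lemma exists_mem_firstArgmax [NeZero p] (σ : Fin p → ℝ) (t : ℝ) (y : EuclideanSpace ℝ (Fin p)) :
    ∃ j, y ∈ firstArgmax σ t j := by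
  classical
  set A := Finset.univ.filter fun j => ∀ k, (y k - t) / σ k ≤ (y j - t) / σ j
  have hA : A.Nonempty := by
    obtain ⟨j, hj⟩ := Finite.exists_max fun k => (y k - t) / σ k
    exact ⟨j, by simpa [A] using hj⟩
  have hj : ∀ k, (y k - t) / σ k ≤ (y (A.min' hA) - t) / σ (A.min' hA) := by
    simpa [A] using A.min'_mem hA
  refine ⟨A.min' hA, fun k => ⟨hj k, fun hk => ?_⟩⟩
  by_contra! h
  have hkA : k ∈ A := by simpa [A] using fun l => (hj l).trans h
  exact absurd (A.min'_le k hkA) (not_le.2 hk)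

/-- On the event that `j` is the first argmax, the law of the standardized coordinate puts on
`(0, η]` at most `R` times the mass it puts on `(η, ∞)`. The coordinate is independent of the
residuals of the regression of the others on it, and given these residuals the event is monotone in
the coordinate, because the correlations are at most `1`. -/
lemma measure_firstArgmax_inter_le {S : Matrix (Fin p) (Fin p) ℝ} (hS : S.PosSemidef)
    {σ : Fin p → ℝ} (hσ : ∀ k, 0 < σ k) (hσS : ∀ k, S k k = σ k ^ 2) (t η : ℝ) (j : Fin p)
    {R : ℝ≥0∞} (hR : gaussianReal 0 1 (Ioc (t / σ j) (t / σ j + η)) ≤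
      R * gaussianReal 0 1 (Ioi (t / σ j + η))) :
    multivariateGaussian 0 S (firstArgmax σ t j ∩ {y | (y j - t) / σ j ∈ Ioc 0 η}) ≤
      R * multivariateGaussian 0 S (firstArgmax σ t j ∩ {y | (y j - t) / σ j ∈ Ioi η}) := by
  set μ := multivariateGaussian 0 S with hμ
  set ρ : Fin p → ℝ := fun k => S j k / (σ j * σ k) with hρ
  have hρ1 : ∀ k, ρ k ≤ 1 := by
    intro k
    have hv : 0 ≤ Var[fun y : EuclideanSpace ℝ (Fin p) => σ k * y j - σ j * y k; μ] :=
      variance_nonneg _ _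
    rw [variance_fun_sub ((memLp_coord_centeredGaussian S j).const_mul _)
      ((memLp_coord_centeredGaussian S k).const_mul _), variance_const_mul, variance_const_mul,
      covariance_const_mul_left, covariance_const_mul_right,
      variance_eval_multivariateGaussian hS, variance_eval_multivariateGaussian hS,
      covariance_eval_multivariateGaussian hS, hσS, hσS] at hv
    have hp : 0 < σ j * σ k := mul_pos (hσ j) (hσ k)
    rw [hρ, div_le_one hp]
    have : 0 ≤ 2 * (σ j * σ k) * (σ j * σ k - S j k) := by linarith
    linarith [nonneg_of_mul_nonneg_right this (by linarith)]
  -- The standardized coordinate and the regression residuals, as linear maps.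
  set U : EuclideanSpace ℝ (Fin p) →L[ℝ] ℝ := (σ j)⁻¹ • EuclideanSpace.proj j with hU
  set V : Fin p → EuclideanSpace ℝ (Fin p) →L[ℝ] ℝ := fun k =>
    (σ k)⁻¹ • EuclideanSpace.proj k - ρ k • U with hV
  have hUa : ∀ y, U y = (σ j)⁻¹ * y j := fun y => by simp [hU]
  have hVa : ∀ k y, V k y = (σ k)⁻¹ * y k - ρ k * ((σ j)⁻¹ * y j) := fun k y => by
    simp [hV, hUa]
  have hlawU : μ.map U = gaussianReal 0 1 := by
    have h1 := (measurePreserving_eval_multivariateGaussian (μ := 0) hS (i := j)).hasLaw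
    have h2 := gaussianReal_const_mul h1 (σ j)⁻¹
    have h3 : (fun y => U y) = fun y : EuclideanSpace ℝ (Fin p) => (σ j)⁻¹ * y j := funext hUa
    rw [show (⇑U) = fun y : EuclideanSpace ℝ (Fin p) => (σ j)⁻¹ * y j from h3, h2.map_eq]
    congr 1
    · simp
    · ext
      have := (hσ j).ne'
      simp only [hσS j, inv_pow, NNReal.coe_mul, NNReal.coe_mk, NNReal.coe_one,
        Real.coe_toNNReal _ (sq_nonneg (σ j))]
      field_simp
  have hind : IndepFun (fun y => U y) (fun y k => V k y) μ := by
    have hG : HasGaussianLaw (fun y => ((fun _ : Unit => U y), fun k => V k y)) μ :=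
      IsGaussian.hasGaussianLaw_id.map ((ContinuousLinearMap.pi fun _ : Unit => U).prod
        (ContinuousLinearMap.pi V))
    refine (hG.indepFun_of_covariance_eval (X := fun _ y => U y) (Y := fun k y => V k y)
      fun _ k => ?_).comp (measurable_pi_apply ()) measurable_id
    simp_rw [hUa, hVa]
    rw [covariance_fun_sub_right ((memLp_coord_centeredGaussian S j).const_mul _)
      ((memLp_coord_centeredGaussian S k).const_mul _)
      (((memLp_coord_centeredGaussian S j).const_mul _).const_mul _)]
    simp_rw [covariance_const_mul_left, covariance_const_mul_right]
    rw [covariance_eval_multivariateGaussian hS, covariance_eval_multivariateGaussian hS, hσS j, hρ]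
    have h1 := (hσ j).ne'
    have h2 := (hσ k).ne'
    field_simp
    ring
  have hmV : Measurable fun y : EuclideanSpace ℝ (Fin p) => fun k => V k y := by fun_prop
  have hmU : Measurable fun y : EuclideanSpace ℝ (Fin p) => U y := by fun_prop
  have hprod := (indepFun_iff_map_prod_eq_prod_map_map hmU.aemeasurable hmV.aemeasurable).1 hind
  have hlawU' : μ.map (fun y => U y) = gaussianReal 0 1 := hlawU
  rw [hlawU'] at hprod
  have hsf : IsProbabilityMeasure (μ.map fun y k => V k y) :=
    Measure.isProbabilityMeasure_map hmV.aemeasurable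
  set B : Set (ℝ × (Fin p → ℝ)) := {q | ∀ k, q.2 k + ρ k * q.1 - t / σ k ≤ q.1 - t / σ j ∧
    (k < j → q.2 k + ρ k * q.1 - t / σ k < q.1 - t / σ j)} with hBdef
  have hW : ∀ k y, (y k - t) / σ k = V k y + ρ k * U y - t / σ k := by
    intro k y
    rw [hVa, hUa]
    ring
  have hWj : ∀ y, (y j - t) / σ j = U y - t / σ j := by
    intro y
    rw [hUa]
    ring
  have hB : MeasurableSet B := by
    have : B = ⋂ k, ({q | q.2 k + ρ k * q.1 - t / σ k ≤ q.1 - t / σ j} ∩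
        {q | k < j → q.2 k + ρ k * q.1 - t / σ k < q.1 - t / σ j}) := by
      ext y
      simp [hBdef]
    rw [this]
    refine MeasurableSet.iInter fun k => (measurableSet_le (by fun_prop) (by fun_prop)).inter ?_
    by_cases h : k < j
    · simpa [h] using measurableSet_lt
        (f := fun q : ℝ × (Fin p → ℝ) => q.2 k + ρ k * q.1 - t / σ k)
        (g := fun q => q.1 - t / σ j) (by fun_prop) (by fun_prop)
    · simp [h]
  have hup : ∀ u u' v, (u, v) ∈ B → u ≤ u' → (u', v) ∈ B := by
    intro u u' v h huu k
    have hk := h k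
    have hm := mul_le_mul_of_nonneg_right huu (sub_nonneg.2 (hρ1 k))
    simp only at hk ⊢
    exact ⟨by linarith [hk.1], fun hkj => by linarith [hk.2 hkj]⟩
  have key := prod_inter_Ioc_le (ν := μ.map fun y k => V k y) hB hup hR
  rw [← hprod, Measure.map_apply (hmU.prodMk hmV) (hB.inter (measurable_fst measurableSet_Ioc)),
    Measure.map_apply (hmU.prodMk hmV) (hB.inter (measurable_fst measurableSet_Ioi))] at key
  have hset : ∀ y, y ∈ firstArgmax σ t j ↔ (U y, fun k => V k y) ∈ B := by
    intro y
    simp only [firstArgmax, hBdef, mem_ofPred_eq]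
    refine forall_congr' fun k => ?_
    rw [hW k, hWj]
  convert key using 2
  · ext y
    simp only [mem_inter_iff, mem_ofPred_eq, mem_preimage, hset, hWj, mem_Ioc]
    refine and_congr_right fun _ => ⟨fun h => ⟨by linarith [h.1], by linarith [h.2]⟩,
      fun h => ⟨by linarith [h.1], by linarith [h.2]⟩⟩
  · congr 1
    ext y
    simp only [mem_inter_iff, mem_ofPred_eq, mem_preimage, hset, hWj, mem_Ioi]
    refine and_congr_right fun _ => ⟨fun h => by linarith, fun h => by linarith⟩

lemma measurable_maxCoord [NeZero p] :
    Measurable fun y : EuclideanSpace ℝ (Fin p) => maxCoord y := by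
  unfold maxCoord
  exact Measurable.iSup fun j => by fun_prop

/-- The hazard-rate bound for the maximum coordinate. The strip is split according to the first
index at which `(y j - t) / σ j` is largest; this largest ratio is positive exactly when `max y`
exceeds `t`. -/
lemma measure_maxCoord_mem_Ioc_le [NeZero p] {S : Matrix (Fin p) (Fin p) ℝ} (hS : S.PosSemidef)
    {s : ℝ} (hs : 0 < s) (hsS : ∀ k, s ^ 2 ≤ S k k) {t ε : ℝ} (hε : 0 < ε)
    (hη : ε / s * (1 + max 0 (t / s)) ≤ 1) :
    multivariateGaussian 0 S {y | maxCoord y ∈ Ioc t (t + ε)} ≤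
      ENNReal.ofReal (Real.exp 4 * (ε / s * (1 + max 0 (t / s)))) *
        multivariateGaussian 0 S {y | t < maxCoord y} := by
  set μ := multivariateGaussian 0 S with hμ
  set σ : Fin p → ℝ := fun k => √(S k k) with hσdef
  have hσS : ∀ k, S k k = σ k ^ 2 := fun k =>
    (Real.sq_sqrt ((sq_nonneg s).trans (hsS k))).symm
  have hsσ : ∀ k, s ≤ σ k := fun k => Real.le_sqrt_of_sq_le (hsS k)
  have hσ : ∀ k, 0 < σ k := fun k => hs.trans_le (hsσ k)
  set η := ε / s with hηdef
  have hη0 : 0 < η := div_pos hε hs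
  set A := max 0 (t / s) with hA
  set R := ENNReal.ofReal (Real.exp 4 * (η * (1 + A))) with hR
  have haA : ∀ j, t / σ j ≤ A := by
    intro j
    rcases le_total 0 t with h | h
    · exact (div_le_div_of_nonneg_left h hs (hsσ j)).trans (le_max_right _ _)
    · exact (div_nonpos_of_nonpos_of_nonneg h (hσ j).le).trans (le_max_left _ _)
  have hj : ∀ j, μ (firstArgmax σ t j ∩ {y | (y j - t) / σ j ∈ Ioc 0 η}) ≤
      R * μ (firstArgmax σ t j ∩ {y | (y j - t) / σ j ∈ Ioi η}) := fun j =>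
    measure_firstArgmax_inter_le hS hσ hσS t η j
      (gaussianReal_Ioc_le (haA j) (le_max_left _ _) hη0 hη)
  have hcover : {y : EuclideanSpace ℝ (Fin p) | maxCoord y ∈ Ioc t (t + ε)} ⊆
      ⋃ j, firstArgmax σ t j ∩ {y | (y j - t) / σ j ∈ Ioc 0 η} := by
    intro y hy
    obtain ⟨j, hj⟩ := exists_mem_firstArgmax σ t y
    refine mem_iUnion.2 ⟨j, hj, ?_, ?_⟩
    · obtain ⟨i, hi⟩ : ∃ i, t < y i := by
        by_contra! h
        exact absurd (maxCoord_le_iff.2 h) (not_le.2 hy.1)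
      exact (div_pos (sub_pos.2 hi) (hσ i)).trans_le (hj i).1
    · have : y j - t ≤ ε := by linarith [(le_maxCoord y j).trans hy.2]
      exact (div_le_div_of_nonneg_right this (hσ j).le).trans
        (div_le_div_of_nonneg_left hε.le hs (hsσ j))
  have hdisj : Pairwise (Function.onFun Disjoint fun j =>
      firstArgmax σ t j ∩ {y | (y j - t) / σ j ∈ Ioi η}) := fun j k hjk =>
    (disjoint_firstArgmax σ t hjk).mono inter_subset_left inter_subset_left
  have hmeas : ∀ j, MeasurableSet (firstArgmax σ t j ∩ {y | (y j - t) / σ j ∈ Ioi η}) := fun j =>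
    (measurableSet_firstArgmax σ t j).inter (measurableSet_Ioi.preimage
      (f := fun y : EuclideanSpace ℝ (Fin p) => (y j - t) / σ j) (by fun_prop))
  have hunion : (⋃ j, firstArgmax σ t j ∩ {y | (y j - t) / σ j ∈ Ioi η}) ⊆
      {y : EuclideanSpace ℝ (Fin p) | t < maxCoord y} := by
    intro y hy
    obtain ⟨j, -, hj⟩ := mem_iUnion.1 hy
    have h1 : 0 < (y j - t) / σ j := hη0.trans hj
    have h2 : 0 < y j - t := (div_pos_iff_of_pos_right (hσ j)).1 h1
    exact lt_of_lt_of_le (by linarith) (le_maxCoord y j)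
  calc μ {y | maxCoord y ∈ Ioc t (t + ε)}
      ≤ μ (⋃ j, firstArgmax σ t j ∩ {y | (y j - t) / σ j ∈ Ioc 0 η}) := measure_mono hcover
    _ ≤ ∑ j, μ (firstArgmax σ t j ∩ {y | (y j - t) / σ j ∈ Ioc 0 η}) :=
        measure_iUnion_fintype_le _ _
    _ ≤ ∑ j, R * μ (firstArgmax σ t j ∩ {y | (y j - t) / σ j ∈ Ioi η}) :=
        Finset.sum_le_sum fun j _ => hj j
    _ = R * μ (⋃ j, firstArgmax σ t j ∩ {y | (y j - t) / σ j ∈ Ioi η}) := by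
        rw [measure_iUnion hdisj hmeas, tsum_fintype, Finset.mul_sum]
    _ ≤ R * μ {y | t < maxCoord y} := by
        gcongr

lemma measureReal_le_coord_le {S : Matrix (Fin p) (Fin p) ℝ} (hS : S.PosSemidef) {C : ℝ}
    (hC : 0 < C) {j : Fin p} (hSC : S j j ≤ C) {t : ℝ} (ht : 0 ≤ t) :
    (multivariateGaussian 0 S).real {y | t ≤ y j} ≤ Real.exp (-(t ^ 2 / (2 * C))) := by
  have hlaw := (measurePreserving_eval_multivariateGaussian (μ := 0) hS (i := j)).map_eq
  have h0 : ((0 : EuclideanSpace ℝ (Fin p)) j) = 0 := rfl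
  have hSj : 0 ≤ S j j := hS.diag_nonneg
  rw [h0] at hlaw
  have hint : Integrable (fun y : EuclideanSpace ℝ (Fin p) => Real.exp (t / C * y j))
      (multivariateGaussian 0 S) := by
    have h1 := integrable_exp_mul_gaussianReal (μ := 0) (v := (S j j).toNNReal) (t / C)
    rw [← hlaw, integrable_map_measure (by fun_prop) (by fun_prop)] at h1
    exact h1
  refine (measure_ge_le_exp_mul_mgf (X := fun y : EuclideanSpace ℝ (Fin p) => y j) t
    (div_nonneg ht hC.le) hint).trans ?_
  rw [mgf_gaussianReal hlaw, ← Real.exp_add, Real.exp_le_exp, Real.coe_toNNReal _ hSj]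
  have h2 : S j j * (t / C) ^ 2 ≤ C * (t / C) ^ 2 :=
    mul_le_mul_of_nonneg_right hSC (sq_nonneg _)
  have h3 : C * (t / C) ^ 2 = t ^ 2 / C := by field_simp
  have h4 : -(t / C) * t = -(t ^ 2 / C) := by ring
  have h5 : t ^ 2 / (2 * C) = t ^ 2 / C / 2 := by ring
  rw [h4, h5]
  linarith

/-- **Anti-concentration** for the maximum of a Gaussian vector whose coordinates have variances
in `[c, C]`: the concentration function is at most of order `ε √(log p)`. -/
theorem exists_measureReal_maxCoord_mem_Ioc_le {c C : ℝ} (hc : 0 < c) (hcC : c < C) :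
    ∃ K : ℝ, 0 < K ∧ ∀ (p : ℕ) (_ : 3 ≤ p) (S : Matrix (Fin p) (Fin p) ℝ), S.PosSemidef →
      (∀ j, c ≤ S j j) → (∀ j, S j j ≤ C) → ∀ t ε : ℝ, 0 < ε →
        (multivariateGaussian 0 S).real {y | maxCoord y ∈ Ioc t (t + ε)} ≤
          K * (ε * √(Real.log p)) := by
  have hC : 0 < C := hc.trans hcC
  set s := √c with hs
  have hs0 : 0 < s := Real.sqrt_pos.2 hc
  have hs2 : s ^ 2 = c := Real.sq_sqrt hc.le
  refine ⟨Real.exp 4 / s * (2 + C / c + √(4 * C) / s), by positivity, ?_⟩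
  intro p hp S hS hcS hSC t ε hε
  have : NeZero p := ⟨by omega⟩
  set μ := multivariateGaussian 0 S with hμ
  set ℓ := Real.log p with hℓ
  have hp0 : (0 : ℝ) < p := by exact_mod_cast (by omega : 0 < p)
  have hℓ1 : 1 ≤ ℓ := by
    rw [hℓ, Real.le_log_iff_exp_le hp0]
    have : (3 : ℝ) ≤ p := by exact_mod_cast hp
    linarith [Real.exp_one_lt_d9]
  have hℓs : 1 ≤ √ℓ := Real.one_le_sqrt.2 hℓ1
  set A := max 0 (t / s) with hA
  have hA0 : 0 ≤ A := le_max_left _ _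
  have he4 : 1 ≤ Real.exp 4 := Real.one_le_exp (by norm_num)
  have hmain : μ.real {y | maxCoord y ∈ Ioc t (t + ε)} ≤
      Real.exp 4 * (ε / s * (1 + A)) * μ.real {y | t < maxCoord y} := by
    rcases le_or_gt (ε / s * (1 + A)) 1 with h | h
    · have := measure_maxCoord_mem_Ioc_le hS hs0 (fun k => by rw [hs2]; exact hcS k) hε h
      have h2 := ENNReal.toReal_mono (ENNReal.mul_ne_top ENNReal.ofReal_ne_top
        (measure_ne_top _ _)) this
      rwa [ENNReal.toReal_mul, ENNReal.toReal_ofReal (by positivity)] at h2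
    · calc μ.real {y | maxCoord y ∈ Ioc t (t + ε)} ≤ μ.real {y | t < maxCoord y} :=
            measureReal_mono fun y hy => hy.1
        _ ≤ Real.exp 4 * (ε / s * (1 + A)) * μ.real {y | t < maxCoord y} :=
            le_mul_of_one_le_left measureReal_nonneg (by nlinarith)
  -- It remains to bound `(1 + A) * μ {t < max}`: trivially for small `t`, and by the union bound
  -- `p * exp (-t² / (2C)) ≤ exp (-t² / (4C))` for large `t`.
  have hred : (1 + A) * μ.real {y | t < maxCoord y} ≤
      (2 + C / c + √(4 * C) / s) * √ℓ := by
    have hCc : 0 ≤ C / c := by positivity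
    have hCs : 0 ≤ √(4 * C) / s := by positivity
    rcases le_or_gt t (√(4 * C) * √ℓ) with h | h
    · have h1 : A ≤ √(4 * C) / s * √ℓ := by
        refine max_le (by positivity) ?_
        rw [div_mul_eq_mul_div]
        exact div_le_div_of_nonneg_right h hs0.le
      calc (1 + A) * μ.real {y | t < maxCoord y} ≤ (1 + A) * 1 := by
            gcongr
            exact measureReal_le_one
        _ ≤ (2 + C / c + √(4 * C) / s) * √ℓ := by nlinarith
    · have ht0 : 0 < t := lt_of_le_of_lt (by positivity) h
      have hAt : A = t / s := max_eq_right (by positivity)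
      have ht2 : ℓ ≤ t ^ 2 / (4 * C) := by
        have := pow_le_pow_left₀ (by positivity) h.le 2
        rw [mul_pow, Real.sq_sqrt (by positivity), Real.sq_sqrt (by positivity)] at this
        rw [le_div_iff₀ (by positivity)]
        linarith
      set x := t ^ 2 / (4 * C) with hx
      have htail : μ.real {y | t < maxCoord y} ≤ Real.exp (-x) := by
        have hsub : {y : EuclideanSpace ℝ (Fin p) | t < maxCoord y} ⊆ ⋃ j, {y | t ≤ y j} := by
          intro y hy
          by_contra hcon
          simp only [mem_iUnion, mem_ofPred_eq, not_exists, not_le] at hcon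
          exact absurd (maxCoord_le_iff.2 fun j => (hcon j).le) (not_le.2 hy)
        calc μ.real {y | t < maxCoord y} ≤ μ.real (⋃ j, {y | t ≤ y j}) := measureReal_mono hsub
          _ ≤ ∑ j, μ.real {y | t ≤ y j} := measureReal_iUnion_fintype_le _
          _ ≤ ∑ _j : Fin p, Real.exp (-(t ^ 2 / (2 * C))) :=
              Finset.sum_le_sum fun j _ => measureReal_le_coord_le hS hC (hSC j) ht0.le
          _ = Real.exp (ℓ + -(t ^ 2 / (2 * C))) := by
              rw [Real.exp_add, hℓ, Real.exp_log hp0]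
              simp
          _ ≤ Real.exp (-x) := by
              rw [Real.exp_le_exp]
              have : t ^ 2 / (2 * C) = 2 * x := by
                rw [hx]
                field_simp
                ring
              linarith
      have hx1 : (1 + x) * Real.exp (-x) ≤ 1 := by
        rw [Real.exp_neg, ← div_eq_mul_inv, div_le_one (Real.exp_pos _)]
        linarith [Real.add_one_le_exp x]
      have hx0 : 0 ≤ x := by positivity
      have hAx : 1 + A ≤ (2 + C / c) * (1 + x) := by
        have h1 : C / c * x = (t / s) ^ 2 / 4 := by
          rw [hx, div_pow, hs2]
          field_simp
        have h2 : A ≤ 1 + C / c * x := by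
          rw [h1, hAt]
          nlinarith [sq_nonneg (t / s / 2 - 1)]
        nlinarith
      calc (1 + A) * μ.real {y | t < maxCoord y}
          ≤ (2 + C / c) * (1 + x) * Real.exp (-x) := by gcongr
        _ ≤ 2 + C / c := by
            rw [mul_assoc]
            exact mul_le_of_le_one_right (by positivity) hx1
        _ ≤ (2 + C / c + √(4 * C) / s) * √ℓ := by nlinarith
  calc μ.real {y | maxCoord y ∈ Ioc t (t + ε)}
      ≤ Real.exp 4 * (ε / s * (1 + A)) * μ.real {y | t < maxCoord y} := hmain
    _ = Real.exp 4 / s * ε * ((1 + A) * μ.real {y | t < maxCoord y}) := by ring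
    _ ≤ Real.exp 4 / s * ε * ((2 + C / c + √(4 * C) / s) * √ℓ) := by gcongr
    _ = _ := by ring

end AntiConcentration

/-! ### Comparison of Gaussian maxima -/

section Comparison

open Set

lemma measureReal_le_one_sub_integral {E : Type*} [MeasurableSpace E] {μ : Measure E}
    [IsProbabilityMeasure μ] {g : E → ℝ} (hg : Measurable g) (hg0 : ∀ x, 0 ≤ g x)
    (hg1 : ∀ x, g x ≤ 1) {s : Set E} (hs : MeasurableSet s) (h : ∀ x ∈ s, g x = 0) :
    μ.real s ≤ 1 - ∫ x, g x ∂μ := by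
  have hgi : Integrable g μ := integrable_of_abs_le hg (B := 1) fun x => by
    rw [abs_of_nonneg (hg0 x)]
    exact hg1 x
  have h1 : ∫ x, g x ∂μ ≤ ∫ x, sᶜ.indicator (fun _ => (1 : ℝ)) x ∂μ := by
    refine integral_mono hgi ((integrable_const 1).indicator hs.compl) fun x => ?_
    by_cases hx : x ∈ s
    · simp [hx, h x hx]
    · simp [hx, hg1 x]
  rw [integral_indicator_const _ hs.compl, smul_eq_mul, mul_one, probReal_compl_eq_one_sub hs] at h1
  linarith

lemma one_sub_integral_le_measureReal {E : Type*} [MeasurableSpace E] {μ : Measure E}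
    [IsProbabilityMeasure μ] {g : E → ℝ} (hg : Measurable g) (hg0 : ∀ x, 0 ≤ g x)
    (hg1 : ∀ x, g x ≤ 1) {s : Set E} (hs : MeasurableSet s) (h : ∀ x ∉ s, g x = 1) :
    1 - ∫ x, g x ∂μ ≤ μ.real s := by
  have hgi : Integrable g μ := integrable_of_abs_le hg (B := 1) fun x => by
    rw [abs_of_nonneg (hg0 x)]
    exact hg1 x
  have h1 : ∫ x, sᶜ.indicator (fun _ => (1 : ℝ)) x ∂μ ≤ ∫ x, g x ∂μ := by
    refine integral_mono ((integrable_const 1).indicator hs.compl) hgi fun x => ?_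
    by_cases hx : x ∈ s
    · simp [hx, hg0 x]
    · simp [hx, h x hx]
  rw [integral_indicator_const _ hs.compl, smul_eq_mul, mul_one, probReal_compl_eq_one_sub hs] at h1
  linarith

lemma measureReal_maxCoord_le_add {p : ℕ} [NeZero p] (μ : Measure (EuclideanSpace ℝ (Fin p)))
    [IsProbabilityMeasure μ] {t u : ℝ} (htu : t ≤ u) :
    μ.real {y | maxCoord y ≤ u} =
      μ.real {y | maxCoord y ≤ t} + μ.real {y | maxCoord y ∈ Ioc t u} := by
  have hm : MeasurableSet {y : EuclideanSpace ℝ (Fin p) | maxCoord y ∈ Ioc t u} :=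
    measurable_maxCoord measurableSet_Ioc
  have hd : Disjoint {y : EuclideanSpace ℝ (Fin p) | maxCoord y ≤ t} {y | maxCoord y ∈ Ioc t u} :=
    disjoint_left.2 fun y hy hy' => not_lt.2 (show maxCoord y ≤ t from hy) hy'.1
  rw [← measureReal_union hd hm]
  congr 1
  ext y
  simp only [mem_ofPred_eq, mem_union, mem_Ioc]
  constructor
  · intro h
    rcases le_or_gt (maxCoord y) t with h1 | h1
    · exact Or.inl h1
    · exact Or.inr ⟨h1, h⟩
  · rintro (h | h)
    · exact h.trans htu
    · exact h.2

/-- **Gaussian comparison** for maxima in Kolmogorov distance: if the covariance matrices are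
entrywise within `ϑ` and one of them has its diagonal in `[c, C]`, the distribution functions of
the maxima differ by at most the order of `ϑ^{1/3} (log p)^{2/3}`. -/
theorem exists_abs_measureReal_maxCoord_sub_le {c C : ℝ} (hc : 0 < c) (hcC : c < C) :
    ∃ K : ℝ, 0 < K ∧ ∀ (p : ℕ) (_ : 3 ≤ p) (S S' : Matrix (Fin p) (Fin p) ℝ), S.PosSemidef →
      S'.PosSemidef → (∀ j, c ≤ S' j j) → (∀ j, S' j j ≤ C) → ∀ ϑ : ℝ, 0 < ϑ →
      (∀ j k, |S j k - S' j k| ≤ ϑ) → ∀ t : ℝ,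
        |(multivariateGaussian 0 S).real {y | maxCoord y ≤ t} -
          (multivariateGaussian 0 S').real {y | maxCoord y ≤ t}| ≤
          K * (ϑ ^ (1 / 3 : ℝ) * Real.log p ^ (2 / 3 : ℝ)) := by
  obtain ⟨ψ₁, ψ₂, ψ₃, A, hψ⟩ := exists_smoothStep
  obtain ⟨K, hK0, hK⟩ := exists_measureReal_maxCoord_mem_Ioc_le hc hcC
  have hA0 : 0 ≤ A := (abs_nonneg _).trans (hψ.bound₁ 0)
  refine ⟨2 * A + 2 * K, by positivity, ?_⟩
  intro p hp S S' hS hS' hcS hSC ϑ hϑ hΔ t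
  have : NeZero p := ⟨by omega⟩
  set ℓ := Real.log p with hℓ
  have hp0 : (0 : ℝ) < p := by exact_mod_cast (by omega : 0 < p)
  have hℓ1 : 1 ≤ ℓ := by
    rw [hℓ, Real.le_log_iff_exp_le hp0]
    have : (3 : ℝ) ≤ p := by exact_mod_cast hp
    linarith [Real.exp_one_lt_d9]
  have hℓ0 : 0 < ℓ := by linarith
  -- With `u = ϑ^{1/3}` and `w = ℓ^{1/6}`, all exponents become integers.
  set u := ϑ ^ (1 / 3 : ℝ) with hu
  set w := ℓ ^ (1 / 6 : ℝ) with hw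
  have hu0 : 0 < u := Real.rpow_pos_of_pos hϑ _
  have hw0 : 0 < w := Real.rpow_pos_of_pos hℓ0 _
  have hu3 : u ^ 3 = ϑ := by
    rw [hu, ← Real.rpow_natCast, ← Real.rpow_mul hϑ.le]
    norm_num
  have hw6 : w ^ 6 = ℓ := by
    rw [hw, ← Real.rpow_natCast, ← Real.rpow_mul hℓ0.le]
    norm_num
  have hw4 : ℓ ^ (2 / 3 : ℝ) = w ^ 4 := by
    rw [hw, ← Real.rpow_natCast, ← Real.rpow_mul hℓ0.le]
    norm_num
  have hw3 : √ℓ = w ^ 3 := by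
    rw [← hw6, show w ^ 6 = (w ^ 3) ^ 2 by ring, Real.sqrt_sq (by positivity)]
  rw [hw4]
  -- This `δ` balances the smoothing error `ϑ ℓ / δ²` and the anti-concentration error `δ √ℓ`.
  set δ := u * w with hδ
  have hδ0 : 0 < δ := mul_pos hu0 hw0
  set β := ℓ / δ with hβ
  have hβ0 : 0 < β := div_pos hℓ0 hδ0
  have hlogβ : ℓ / β = δ := by
    rw [hβ]
    field_simp
  set a := 1 / δ with ha
  have ha0 : 0 < a := by positivity
  have haδ : a * δ = 1 := by
    rw [ha]
    field_simp
  set g : ℝ → EuclideanSpace ℝ (Fin p) → ℝ := fun b x =>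
    Real.smoothTransition (a * smoothMax β x + b) with hg
  have hgm : ∀ b, Measurable (g b) := fun b =>
    (Real.smoothTransition.continuous.measurable).comp
      (((measurable_smoothMax β).const_mul a).add_const b)
  have hg0 : ∀ b x, 0 ≤ g b x := fun b x => Real.smoothTransition.nonneg _
  have hg1 : ∀ b x, g b x ≤ 1 := fun b x => Real.smoothTransition.le_one _
  have hgB : ∀ b x, |g b x| ≤ 1 := fun b x => by
    rw [abs_of_nonneg (hg0 b x)]
    exact hg1 b x
  have hcomp : ∀ b, |∫ x, g b x ∂(multivariateGaussian 0 S) -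
      ∫ x, g b x ∂(multivariateGaussian 0 S')| ≤ 2 * A * (u * w ^ 4) := by
    intro b
    refine (abs_integral_gaussian_sub_le (hgm b) (hgB b) (hasTaylorTwo_step hψ ha0.le hβ0) hS hS'
      hΔ hϑ.le).trans ?_
    have h1 : a ^ 2 * ϑ = u * w ^ 4 / ℓ := by
      rw [ha, hδ, ← hu3, ← hw6]
      field_simp
    have h2 : a * β * ϑ = u * w ^ 4 := by
      rw [ha, hβ, hδ, ← hu3, ← hw6]
      field_simp
    have h3 : u * w ^ 4 / ℓ ≤ u * w ^ 4 := div_le_self (by positivity) hℓ1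
    have h4 : 0 ≤ A * (u * w ^ 4) := by positivity
    calc (a ^ 2 * A + 2 * (a * β * A)) * ϑ / 2 = A * (a ^ 2 * ϑ) / 2 + A * (a * β * ϑ) := by ring
      _ = A * (u * w ^ 4 / ℓ) / 2 + A * (u * w ^ 4) := by rw [h1, h2]
      _ ≤ A * (u * w ^ 4) / 2 + A * (u * w ^ 4) := by gcongr
      _ ≤ 2 * A * (u * w ^ 4) := by linarith
  have hmeas : ∀ r : ℝ, MeasurableSet {y : EuclideanSpace ℝ (Fin p) | maxCoord y ≤ r} := fun r =>
    measurable_maxCoord measurableSet_Iic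
  have hanti : ∀ r : ℝ, (multivariateGaussian 0 S').real {y | maxCoord y ∈ Ioc r (r + 2 * δ)} ≤
      2 * K * (u * w ^ 4) := by
    intro r
    refine (hK p hp S' hS' hcS hSC r (2 * δ) (by positivity)).trans (le_of_eq ?_)
    rw [← hℓ, hw3, hδ]
    ring
  -- The smoothed indicator below vanishes for `max ≤ t` and equals `1` for `max > t + 2δ`.
  have hupper : (multivariateGaussian 0 S).real {y | maxCoord y ≤ t} ≤
      (multivariateGaussian 0 S').real {y | maxCoord y ≤ t} + (2 * A + 2 * K) * (u * w ^ 4) := by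
    set b := -(a * (t + δ)) with hb
    have h1 := measureReal_le_one_sub_integral (μ := multivariateGaussian 0 S) (hgm b) (hg0 b)
      (hg1 b) (hmeas t) fun y hy => by
        refine Real.smoothTransition.zero_of_nonpos ?_
        have h2 : smoothMax β y ≤ t + δ := by
          have h3 := smoothMax_le hβ0 y
          rw [← hℓ, hlogβ] at h3
          have h4 : maxCoord y ≤ t := hy
          linarith
        rw [hb]
        nlinarith
    have h2 := one_sub_integral_le_measureReal (μ := multivariateGaussian 0 S') (hgm b) (hg0 b)
      (hg1 b) (hmeas (t + 2 * δ)) fun y hy => by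
        refine Real.smoothTransition.one_of_one_le ?_
        have h3 : t + 2 * δ < maxCoord y := not_le.1 hy
        have h4 := maxCoord_le_smoothMax hβ0 y
        rw [hb]
        nlinarith
    have h3 := (abs_le.1 (hcomp b)).1
    have h4 := measureReal_maxCoord_le_add (multivariateGaussian 0 S')
      (show t ≤ t + 2 * δ by linarith)
    linarith [hanti t]
  -- This one vanishes for `max ≤ t - 2δ` and equals `1` for `max > t`.
  have hlower : (multivariateGaussian 0 S').real {y | maxCoord y ≤ t} -
      (2 * A + 2 * K) * (u * w ^ 4) ≤ (multivariateGaussian 0 S).real {y | maxCoord y ≤ t} := by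
    set b := 1 - a * t with hb
    have h1 := measureReal_le_one_sub_integral (μ := multivariateGaussian 0 S') (hgm b) (hg0 b)
      (hg1 b) (hmeas (t - 2 * δ)) fun y hy => by
        refine Real.smoothTransition.zero_of_nonpos ?_
        have h2 : smoothMax β y ≤ t - δ := by
          have h3 := smoothMax_le hβ0 y
          rw [← hℓ, hlogβ] at h3
          have h4 : maxCoord y ≤ t - 2 * δ := hy
          linarith
        rw [hb]
        nlinarith
    have h2 := one_sub_integral_le_measureReal (μ := multivariateGaussian 0 S) (hgm b) (hg0 b)
      (hg1 b) (hmeas t) fun y hy => by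
        refine Real.smoothTransition.one_of_one_le ?_
        have h3 : t < maxCoord y := not_le.1 hy
        have h4 := maxCoord_le_smoothMax hβ0 y
        rw [hb]
        nlinarith
    have h3 := (abs_le.1 (hcomp b)).2
    have h4 := measureReal_maxCoord_le_add (multivariateGaussian 0 S')
      (show t - 2 * δ ≤ t by linarith)
    have h5 := hanti (t - 2 * δ)
    rw [sub_add_cancel] at h5
    linarith
  rw [abs_le]
  constructor <;> linarith

end Comparison

/-! ### The bootstrap statistics and their laws -/

section Statistics

open Set Matrix

variable {Ω : Type*} [MeasurableSpace Ω] {P : Measure Ω} {n p : ℕ}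

lemma posSemidef_secondMoment {ξ : Ω → EuclideanSpace ℝ (Fin p)}
    (hξ : MemLp ξ 2 P) : (secondMoment P ξ).PosSemidef := by
  have hc : ∀ j, MemLp (fun ω => ξ ω j) 2 P := fun j =>
    (EuclideanSpace.proj (𝕜 := ℝ) j).comp_memLp' hξ
  refine PosSemidef.of_dotProduct_mulVec_nonneg ?_ fun v => ?_
  · ext j k
    simp [secondMoment, mul_comm]
  · have hi' : ∀ j k, Integrable (fun ω => v j * ξ ω j * (v k * ξ ω k)) P := fun j k =>
      ((hc j).const_mul (v j)).integrable_mul ((hc k).const_mul (v k))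
    have : star v ⬝ᵥ secondMoment P ξ *ᵥ v = ∫ ω, (∑ j, v j * ξ ω j) ^ 2 ∂P := by
      simp_rw [sq, Finset.sum_mul_sum]
      rw [integral_finsetSum _ fun j _ => integrable_finsetSum _ fun k _ => hi' j k]
      simp only [dotProduct, mulVec, secondMoment, of_apply, star_trivial]
      refine Finset.sum_congr rfl fun j _ => ?_
      rw [integral_finsetSum _ fun k _ => hi' j k, Finset.mul_sum]
      refine Finset.sum_congr rfl fun k _ => ?_
      rw [mul_comm (∫ ω, _ ∂P), ← mul_assoc, ← integral_const_mul]
      refine integral_congr_ae (ae_of_all _ fun ω => ?_)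
      ring
    rw [this]
    exact integral_nonneg fun ω => sq_nonneg _

lemma statT_eq_maxCoord {Ω : Type*} (x : Fin n → Ω → EuclideanSpace ℝ (Fin p)) (ω : Ω) :
    statT x ω = maxCoord ((√(n : ℝ))⁻¹ • ∑ i, x i ω) := by
  unfold statT maxSum
  congr 1
  ext j
  simp

lemma measurable_statT [NeZero p] {x : Fin n → Ω → EuclideanSpace ℝ (Fin p)}
    (hx : ∀ i, Measurable (x i)) : Measurable (statT x) := by
  have : statT x = fun ω => maxCoord ((√(n : ℝ))⁻¹ • ∑ i, x i ω) :=
    funext (statT_eq_maxCoord x)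
  rw [this]
  exact measurable_maxCoord.comp (by fun_prop)

lemma inv_sqrt_natCast_sq (n : ℕ) : ((√(n : ℝ))⁻¹) ^ 2 = (n : ℝ)⁻¹ := by
  rw [inv_pow, Real.sq_sqrt (Nat.cast_nonneg n)]

/-- The law of the maximum coordinate of a centered Gaussian vector. -/
noncomputable def maxLaw (S : Matrix (Fin p) (Fin p) ℝ) : Measure ℝ :=
  (multivariateGaussian 0 S).map fun y : EuclideanSpace ℝ (Fin p) => maxCoord y

instance isProbabilityMeasure_maxLaw [NeZero p] (S : Matrix (Fin p) (Fin p) ℝ) :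
    IsProbabilityMeasure (maxLaw S) :=
  Measure.isProbabilityMeasure_map measurable_maxCoord.aemeasurable

lemma maxLaw_real_Iic [NeZero p] (S : Matrix (Fin p) (Fin p) ℝ) (t : ℝ) :
    (maxLaw S).real (Iic t) = (multivariateGaussian 0 S).real {y | maxCoord y ≤ t} :=
  map_measureReal_apply measurable_maxCoord measurableSet_Iic

/-- The distribution function of a non-degenerate Gaussian maximum is continuous, since
anti-concentration makes it Lipschitz. -/
lemma continuous_maxLaw_real_Iic {c C : ℝ} (hc : 0 < c) (hcC : c < C) (hp : 3 ≤ p)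
    {S : Matrix (Fin p) (Fin p) ℝ} (hS : S.PosSemidef) (hcS : ∀ j, c ≤ S j j)
    (hSC : ∀ j, S j j ≤ C) : Continuous fun t => (maxLaw S).real (Iic t) := by
  have : NeZero p := ⟨by omega⟩
  obtain ⟨K, hK0, hK⟩ := exists_measureReal_maxCoord_mem_Ioc_le hc hcC
  have hL : LipschitzWith (K * √(Real.log p)).toNNReal fun t => (maxLaw S).real (Iic t) := by
    refine LipschitzWith.of_le_add_mul _ fun t u => ?_
    rw [Real.coe_toNNReal _ (by positivity)]
    rcases le_or_gt t u with h | h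
    · exact (monotone_measureReal_Iic _ h).trans (le_add_of_nonneg_right (by positivity))
    · have h1 := measureReal_maxCoord_le_add (multivariateGaussian 0 S) h.le
      have h2 := hK p hp S hS hcS hSC u (t - u) (sub_pos.2 h)
      rw [add_sub_cancel] at h2
      rw [maxLaw_real_Iic, maxLaw_real_Iic, h1, Real.dist_eq, abs_of_pos (sub_pos.2 h)]
      linarith
  exact hL.continuous

lemma measureReal_statT_le_eq_maxLaw [IsProbabilityMeasure P] [NeZero p]
    {y : Fin n → Ω → EuclideanSpace ℝ (Fin p)} {S : Fin n → Matrix (Fin p) (Fin p) ℝ}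
    (hS : ∀ i, (S i).PosSemidef) (hy : ∀ i, HasLaw (y i) (multivariateGaussian 0 (S i)) P)
    (hind : iIndepFun y P) (t : ℝ) :
    P.real {ω | statT y ω ≤ t} = (maxLaw ((n : ℝ)⁻¹ • ∑ i, S i)).real (Iic t) := by
  have h := hasLaw_smul_sum_centeredGaussian hS hy hind (√(n : ℝ))⁻¹
  rw [inv_sqrt_natCast_sq] at h
  rw [maxLaw_real_Iic, ← h.measureReal_eq (p := fun v => maxCoord v ≤ t)
    (measurable_maxCoord measurableSet_Iic)]
  simp_rw [statT_eq_maxCoord]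

/-- Given the data, the multiplier statistic is the maximum of a Gaussian vector whose covariance
matrix is the empirical second moment matrix. -/
lemma condCDF_W_eq_maxLaw [IsProbabilityMeasure P] [NeZero p]
    (x : Fin n → Ω → EuclideanSpace ℝ (Fin p)) {e : Fin n → Ω → ℝ}
    (he : ∀ i, HasLaw (e i) (gaussianReal 0 1) P) (hind : iIndepFun e P) (ω : Ω) :
    condCDF_W P x e ω =
      fun t => (maxLaw ((n : ℝ)⁻¹ • ∑ i, vecMulVec (x i ω) (x i ω))).real (Iic t) := by
  ext t
  have hind' : iIndepFun (fun i ω' => e i ω' • x i ω) P :=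
    hind.comp (fun i r => r • x i ω) fun i => by fun_prop
  rw [← measureReal_statT_le_eq_maxLaw (fun i => posSemidef_vecMulVec_self (x i ω))
    (fun i => hasLaw_smul_gaussianReal (he i) (x i ω)) hind' t]
  unfold condCDF_W
  congr 1
  ext ω'
  simp [maxMultSum, statT, maxSum, mul_comm]

end Statistics

/-! ### Bootstrap quantiles -/

section Bootstrap

open Set

/-- If the distribution functions of `ν` and `ν'` are within `r`, a point separated from the
`α`-quantile of one by the `α`-quantile of the other lies where the distribution function of `ν` is
within `r` of `α`. -/
lemma cdf_mem_of_quantile_separates {ν ν' : Measure ℝ} [IsProbabilityMeasure ν]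
    [IsProbabilityMeasure ν'] (hc : Continuous fun t => ν.real (Iic t)) {r : ℝ}
    (hr : ∀ t, |ν'.real (Iic t) - ν.real (Iic t)| ≤ r) {α : ℝ} (hα : α ∈ Ioo (0 : ℝ) 1) {s : ℝ}
    (hs : Xor (s ≤ quantile (fun t => ν'.real (Iic t)) α)
      (s ≤ quantile (fun t => ν.real (Iic t)) α)) :
    α - r ≤ ν.real (Iic s) ∧ ν.real (Iic s) ≤ α + r := by
  have hr0 : 0 ≤ r := (abs_nonneg _).trans (hr 0)
  set q' := quantile (fun t => ν'.real (Iic t)) α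
  set q := quantile (fun t => ν.real (Iic t)) α with hq
  have hFq : ν.real (Iic q) = α := measureReal_Iic_quantile ν hc hα
  rcases hs with ⟨h1, h2⟩ | ⟨h1, h2⟩
  · have h3 : α ≤ ν.real (Iic s) := (quantile_le_iff ν hα s).1 (not_le.1 h2).le
    refine ⟨by linarith, ?_⟩
    -- The bound holds strictly to the left of `s`, hence at `s` by continuity.
    refine le_of_tendsto ((hc.tendsto s).mono_left (nhdsWithin_le_nhds (s := Iio s))) ?_
    filter_upwards [self_mem_nhdsWithin] with u hu
    have h4 : ν'.real (Iic u) < α := by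
      by_contra! h
      exact absurd ((quantile_le_iff ν' hα u).2 h) (not_le.2 (lt_of_lt_of_le hu h1))
    linarith [(abs_le.1 (hr u)).1]
  · have h3 : α ≤ ν'.real (Iic s) := (quantile_le_iff ν' hα s).1 (not_le.1 h2).le
    have h4 : ν.real (Iic s) ≤ α := hFq ▸ monotone_measureReal_Iic ν h1
    exact ⟨by linarith [(abs_le.1 (hr s)).2], by linarith⟩

variable {Ω : Type*} [MeasurableSpace Ω] {P : Measure Ω} [IsProbabilityMeasure P] {n p : ℕ}

lemma abs_measureReal_sub_le_rho (x y : Fin n → Ω → EuclideanSpace ℝ (Fin p)) (t : ℝ) :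
    |P.real {ω | statT x ω ≤ t} - P.real {ω | statT y ω ≤ t}| ≤ rho P x y := by
  refine le_ciSup (f := fun t : ℝ => |P.real {ω | statT x ω ≤ t} - P.real {ω | statT y ω ≤ t}|)
    ⟨1, ?_⟩ t
  rintro _ ⟨u, rfl⟩
  exact abs_sub_le_of_nonneg_of_le measureReal_nonneg measureReal_le_one measureReal_nonneg
    measureReal_le_one

lemma rho_nonneg (x y : Fin n → Ω → EuclideanSpace ℝ (Fin p)) : 0 ≤ rho P x y :=
  (abs_nonneg _).trans (abs_measureReal_sub_le_rho x y 0)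

lemma measureReal_symmDiff_le_rhoSymm (x y : Fin n → Ω → EuclideanSpace ℝ (Fin p))
    (e : Fin n → Ω → ℝ) (α : Ioo (0 : ℝ) 1) :
    P.real (symmDiff {ω | statT x ω ≤ quantileW P x e α ω} {ω | statT x ω ≤ quantileZ P y α}) ≤
      rhoSymm P x y e := by
  refine le_ciSup (f := fun α : Ioo (0 : ℝ) 1 => P.real
    (symmDiff {ω | statT x ω ≤ quantileW P x e α ω} {ω | statT x ω ≤ quantileZ P y α})) ⟨1, ?_⟩ α
  rintro _ ⟨u, rfl⟩
  exact measureReal_le_one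

lemma abs_measureReal_sub_le_symmDiff (A B : Set Ω) :
    |P.real A - P.real B| ≤ P.real (symmDiff A B) := by
  have h1 : P.real A ≤ P.real B + P.real (symmDiff A B) :=
    (measureReal_mono fun ω h => by
      by_cases hB : ω ∈ B
      · exact Or.inl hB
      · exact Or.inr (Or.inl ⟨h, hB⟩)).trans (measureReal_union_le B (symmDiff A B))
  have h2 : P.real B ≤ P.real A + P.real (symmDiff A B) :=
    (measureReal_mono fun ω h => by
      by_cases hA : ω ∈ A
      · exact Or.inl hA
      · exact Or.inr (Or.inr ⟨h, hA⟩)).trans (measureReal_union_le A (symmDiff A B))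
  rw [abs_le]
  constructor <;> linarith

lemma le_piBound {K C ϑ : ℝ} (hK : 0 ≤ K) (hKC : K ≤ C) (hp : 3 ≤ p) (hϑ : 0 < ϑ) (hϑ1 : ϑ ≤ 1) :
    K * (ϑ ^ (1 / 3 : ℝ) * Real.log p ^ (2 / 3 : ℝ)) ≤ piBound C p ϑ := by
  have hp0 : (1 : ℝ) ≤ p := by exact_mod_cast (by omega : 1 ≤ p)
  have hl : Real.log p ≤ max 1 (Real.log (p / ϑ)) :=
    (Real.log_le_log (by linarith) (le_div_self (by linarith) hϑ hϑ1)).trans (le_max_right _ _)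
  have hl0 : 0 ≤ Real.log p := Real.log_nonneg hp0
  have hC0 : 0 ≤ C := hK.trans hKC
  unfold piBound
  rw [mul_assoc]
  gcongr

lemma one_le_piBound {C ϑ : ℝ} (hC : 1 ≤ C) (hϑ1 : 1 ≤ ϑ) : 1 ≤ piBound C p ϑ := by
  have h1 : 1 ≤ ϑ ^ (1 / 3 : ℝ) := Real.one_le_rpow hϑ1 (by norm_num)
  have h2 : 1 ≤ (max 1 (Real.log (p / ϑ))) ^ (2 / 3 : ℝ) :=
    Real.one_le_rpow (le_max_left _ _) (by norm_num)
  exact one_le_mul_of_one_le_of_one_le (one_le_mul_of_one_le_of_one_le hC h1) h2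

end Bootstrap

end MultiplierBootstrap

open MultiplierBootstrap in
theorem theorem3p1 (c₁ C₁ : ℝ) (hc₁ : 0 < c₁) (hcC : c₁ < C₁) :
    ∃ C : ℝ, 0 < C ∧
      ∀ (n p : ℕ) (_ : 3 ≤ p)
        (Ω : Type*) [MeasurableSpace Ω] (P : Measure Ω) [IsProbabilityMeasure P]
        (x y : Fin n → Ω → EuclideanSpace ℝ (Fin p)) (e : Fin n → Ω → ℝ),
        -- the data: independent centered random vectors with finite second moments
        (∀ i, Measurable (x i)) → (∀ i, MemLp (x i) 2 P) →
        (∀ i j, ∫ ω, x i ω j ∂P = 0) → iIndepFun x P →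
        -- the Gaussian analogs: independent, with the covariance matrices of the data
        (∀ i, HasLaw (y i)
          (multivariateGaussian 0 (MultiplierBootstrap.secondMoment P (x i))) P) →
        iIndepFun y P →
        -- the multipliers: i.i.d. standard normal, independent of the data
        (∀ i, HasLaw (e i) (gaussianReal 0 1) P) → iIndepFun e P →
        IndepFun (fun ω i => x i ω) (fun ω i => e i ω) P →
        -- the average second moments of all coordinates lie between the two constants
        (∀ j, c₁ ≤ (n : ℝ)⁻¹ * ∑ i, ∫ ω, (x i ω j) ^ 2 ∂P) →
        (∀ j, (n : ℝ)⁻¹ * ∑ i, ∫ ω, (x i ω j) ^ 2 ∂P ≤ C₁) →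
        (∀ ϑ : ℝ, 0 < ϑ →
          MultiplierBootstrap.rhoSymm P x y e ≤
            2 * (MultiplierBootstrap.rho P x y + MultiplierBootstrap.piBound C p ϑ
              + P.real {ω | ϑ < MultiplierBootstrap.covDeviation P x ω})) ∧
        (⨆ α : Set.Ioo (0 : ℝ) 1,
          |P.real {ω | MultiplierBootstrap.statT x ω ≤
            MultiplierBootstrap.quantileW P x e α ω} - (α : ℝ)|) ≤
          MultiplierBootstrap.rhoSymm P x y e + MultiplierBootstrap.rho P x y := by
  obtain ⟨K, hK0, hK⟩ := exists_abs_measureReal_maxCoord_sub_le hc₁ hcC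
  -- Adding `1` makes the first bound trivial for `ϑ ≥ 1`.
  refine ⟨K + 1, by positivity, ?_⟩
  intro n p hp Ω _ P _ x y e hxm hx2 _ _ hy hyi he hei _ hlo hhi
  have : NeZero p := ⟨by omega⟩
  have : Nonempty (Set.Ioo (0 : ℝ) 1) := ⟨⟨1 / 2, by norm_num⟩⟩
  have hSi : ∀ i, (secondMoment P (x i)).PosSemidef := fun i => posSemidef_secondMoment (hx2 i)
  set S : Matrix (Fin p) (Fin p) ℝ := (n : ℝ)⁻¹ • ∑ i, secondMoment P (x i) with hSdef
  have hn : (0 : ℝ) ≤ (n : ℝ)⁻¹ := by positivity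
  have hS : S.PosSemidef := (Matrix.posSemidef_sum _ fun i _ => hSi i).smul hn
  have hSjj : ∀ j, S j j = (n : ℝ)⁻¹ * ∑ i, ∫ ω, (x i ω j) ^ 2 ∂P := by
    intro j
    simp [hSdef, Matrix.sum_apply, secondMoment, sq]
  have hcS : ∀ j, c₁ ≤ S j j := fun j => (hSjj j).symm ▸ hlo j
  have hSC : ∀ j, S j j ≤ C₁ := fun j => (hSjj j).symm ▸ hhi j
  set ν := maxLaw S with hν
  have hF : ∀ t, P.real {ω | statT y ω ≤ t} = ν.real (Set.Iic t) :=
    measureReal_statT_le_eq_maxLaw hSi hy hyi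
  have hcont : Continuous fun t => ν.real (Set.Iic t) :=
    continuous_maxLaw_real_Iic hc₁ hcC hp hS hcS hSC
  have hqZ : ∀ α, quantileZ P y α = quantile (fun t => ν.real (Set.Iic t)) α := by
    intro α
    unfold quantileZ
    simp_rw [hF]
  have hTm : Measurable (statT x) := measurable_statT hxm
  set μ := P.map (statT x) with hμ
  have : IsProbabilityMeasure μ := Measure.isProbabilityMeasure_map hTm.aemeasurable
  have hT : ∀ t, μ.real (Set.Iic t) = P.real {ω | statT x ω ≤ t} := fun t =>
    map_measureReal_apply hTm measurableSet_Iic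
  have hρ : ∀ t, |μ.real (Set.Iic t) - ν.real (Set.Iic t)| ≤ rho P x y := by
    intro t
    rw [hT, ← hF]
    exact abs_measureReal_sub_le_rho x y t
  have hρ0 : 0 ≤ rho P x y := rho_nonneg x y
  refine ⟨fun ϑ hϑ => ciSup_le fun α => ?_, ciSup_le fun α => ?_⟩
  · rcases le_or_gt 1 ϑ with h1 | h1
    · have h2 : 1 ≤ piBound (K + 1) p ϑ := one_le_piBound (by linarith) h1
      have h3 : (0 : ℝ) ≤ P.real {ω | ϑ < covDeviation P x ω} := measureReal_nonneg
      exact measureReal_le_one.trans (by linarith)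
    set r := piBound (K + 1) p ϑ with hr
    have hKr : K * (ϑ ^ (1 / 3 : ℝ) * Real.log p ^ (2 / 3 : ℝ)) ≤ r :=
      le_piBound hK0.le (by linarith) hp hϑ h1.le
    have hr0 : 0 ≤ r := le_trans (by positivity) hKr
    have hsub : symmDiff {ω | statT x ω ≤ quantileW P x e α ω}
        {ω | statT x ω ≤ quantileZ P y α} ⊆
        {ω | ϑ < covDeviation P x ω} ∪
          statT x ⁻¹' {s | α - r ≤ ν.real (Set.Iic s) ∧ ν.real (Set.Iic s) ≤ α + r} := by
      intro ω hω
      rcases lt_or_ge ϑ (covDeviation P x ω) with h | h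
      · exact Or.inl h
      right
      -- For these data the conditional covariance matrix is within `ϑ` of `S`.
      set S' : Matrix (Fin p) (Fin p) ℝ :=
        (n : ℝ)⁻¹ • ∑ i, Matrix.vecMulVec (x i ω) (x i ω) with hS'def
      have hS' : S'.PosSemidef :=
        (Matrix.posSemidef_sum _ fun i _ => posSemidef_vecMulVec_self (x i ω)).smul hn
      have hΔ : ∀ j k, |S' j k - S j k| ≤ ϑ := by
        intro j k
        have h2 := maxCoord_le_iff.1 (maxCoord_le_iff.1 h j) k
        convert h2 using 2
        simp [hS'def, hSdef, Matrix.sum_apply, Matrix.vecMulVec_apply, Finset.sum_sub_distrib,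
          mul_sub]
      have hcmp : ∀ t, |(maxLaw S').real (Set.Iic t) - ν.real (Set.Iic t)| ≤ r := by
        intro t
        rw [hν, maxLaw_real_Iic, maxLaw_real_Iic]
        exact (hK p hp S' S hS' hS hcS hSC ϑ hϑ hΔ t).trans hKr
      refine cdf_mem_of_quantile_separates (ν' := maxLaw S') hcont hcmp α.2 ?_
      have hqW : quantileW P x e α ω = quantile (fun t => (maxLaw S').real (Set.Iic t)) α := by
        unfold quantileW
        rw [condCDF_W_eq_maxLaw x he hei ω]
      rw [← hqW, ← hqZ]
      exact hω
    have hmeas : MeasurableSet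
        {s | α - r ≤ ν.real (Set.Iic s) ∧ ν.real (Set.Iic s) ≤ α + r} :=
      (measurableSet_le measurable_const hcont.measurable).inter
        (measurableSet_le hcont.measurable measurable_const)
    have hstrip := measureReal_cdf_mem_Icc_le μ ν hcont hρ (l := α - r) (u := α + r)
      (by linarith [α.2.2]) (by linarith [α.2.1]) (by linarith)
    rw [hμ, map_measureReal_apply hTm hmeas] at hstrip
    have h3 : (0 : ℝ) ≤ P.real {ω | ϑ < covDeviation P x ω} := measureReal_nonneg
    have h4 := (measureReal_mono (μ := P) hsub).trans (measureReal_union_le _ _)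
    linarith
  · have hα : P.real {ω | statT y ω ≤ quantileZ P y α} = α := by
      rw [hF, hqZ]
      exact measureReal_Iic_quantile ν hcont α.2
    have h1 := abs_measureReal_sub_le_rho (P := P) x y (quantileZ P y α)
    rw [hα] at h1
    have h2 := (abs_measureReal_sub_le_symmDiff (P := P) _ _).trans
      (measureReal_symmDiff_le_rhoSymm x y e α)
    calc |P.real {ω | statT x ω ≤ quantileW P x e α ω} - (α : ℝ)|
        ≤ |P.real {ω | statT x ω ≤ quantileW P x e α ω} -
            P.real {ω | statT x ω ≤ quantileZ P y α}| +
          |P.real {ω | statT x ω ≤ quantileZ P y α} - (α : ℝ)| := abs_sub_le _ _ _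
      _ ≤ rhoSymm P x y e + rho P x y := add_le_add h2 h1
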